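/- Let $A=\bigoplus_{i\ge 0}A_i$ be an $\mathbb{N}$-graded ring which is left finite (every $A_i$ is a finitely generated left $A_0$-module) and generated in degree $1$ ($A_iA_j=A_{i+j}$ for all $i,j\ge 0$), and suppose that $A_0$ is left noetherian and semiperfect ($A_0/J(A_0)$ is artinian semisimple and idempotents lift modulo the Jacobson radical $J(A_0)$). Let $J=J(A_0)\oplus\bigoplus_{i\ge 1}A_i$ be the graded Jacobson radical of $A$ and let $S=A/J$. For $\mathbb{Z}$-graded left $A$-modules $X,Y$ put $\underline{\mathrm{Ext}}^n_A(X,Y)=\bigoplus_{l\in\mathbb{Z}}\mathrm{Ext}^n_{\mathrm{Gr}A}(X,Y(l))$, where $\mathrm{Gr}A$ is the category of graded left $A$-modules and degree-preserving $A$-linear maps and $Y(l)_k=Y_{k+l}$; a dot denotes the Yoneda product, and the product of two groups of extensions is the subgroup generated by the products of their elements. A graded projective resolution $\cdots\to P_1\xrightarrow{d_1}P_0\xrightarrow{d_0}M\to 0$ is minimal if $\operatorname{Im} d_{n+1}\subseteq JP_n$ for all $n\ge 0$. A graded module $M$ is called quasi-Koszul if it has a minimal graded projective resolution and $J\operatorname{Ker}d_n=\operatorname{Ker}d_n\cap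 J^2P_n$ for all $n\ge 0$ in its minimal graded projective resolution; $A$ is called a quasi-Koszul ring if the graded $A$-module $S$ is quasi-Koszul. (1) Let $M$ be a graded left $A$-module which is left finite (every $M_k$ is a finitely generated $A_0$-module) and bounded below ($M_k=0$ for all sufficiently small $k$). Then $M$ is quasi-Koszul if and only if, for all $n>0$, $$\underline{\mathrm{Ext}}^1_A(S,S)\cdot\underline{\mathrm{Ext}}^{n-1}_A(M,S)=\underline{\mathrm{Ext}}^n_A(M,S).$$ (2) $A$ is a quasi-Koszul ring if and only if the Yoneda Ext ring $E(A)=\bigoplus_{n\ge 0}\underline{\mathrm{Ext}}^n_A(S,S)$ is generated by $\underline{\mathrm{Ext}}^1_A(S,S)$ over $\underline{\mathrm{Hom}}_A(S,S)$, and also if and only if $E(A)$ is generated in degree $1$, that is, $\underline{\mathrm{Ext}}^j_A(S,S)\cdot\underline{\mathrm{Ext}}^i_A(S,S)=\underline{\mathrm{Ext}}^{i+j}_A(S,S)$ for all $i,j\ge 0$. -/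

import Mathlib

universe u

open CategoryTheory CategoryTheory.Limits DirectSum

/-! ### Rings -/

/-- A ring `R` is semiperfect if `R / J(R)` is artinian semisimple and idempotents lift modulo the
Jacobson radical `J(R)`. -/
def IsSemiperfectRing (R : Type*) [Ring R] : Prop :=
  IsSemisimpleRing (R ⧸ Ring.jacobson R) ∧
    ∀ x : R, x * x - x ∈ Ring.jacobson R →
      ∃ e : R, IsIdempotentElem e ∧ e - x ∈ Ring.jacobson R

section Ring

variable {A : Type u} [Ring A] (𝒜 : ℕ → AddSubgroup A) [GradedRing 𝒜]

/-- The additive subgroup `N` of the `A`-module `M` is a finitely generated `A₀`-submodule. -/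
def IsFGOverDegreeZero {M : Type u} [AddCommGroup M] [Module A M] (N : AddSubgroup M) : Prop :=
  ∃ s : Finset M, (Submodule.span (SetLike.GradeZero.subring 𝒜) (s : Set M)).toAddSubgroup = N

/-- `A` is left finite: every `Aₙ` is a finitely generated left `A₀`-module. -/
def IsLeftFiniteRing : Prop := ∀ n, IsFGOverDegreeZero 𝒜 (𝒜 n)

/-- `A` is generated in degree `1`: `Aᵢ Aⱼ = Aᵢ₊ⱼ` for all `i, j ≥ 0`. -/
def IsGeneratedInDegreeOne : Prop :=
  ∀ i j : ℕ, AddSubgroup.closure {x : A | ∃ a ∈ 𝒜 i, ∃ b ∈ 𝒜 j, x = a * b} = 𝒜 (i + j)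

/-- The graded Jacobson radical `J = J(A₀) ⊕ A_{≥ 1}`, that is, the set of all elements whose
component of degree `0` lies in `J(A₀)`. -/
noncomputable def gradedRadical : Ideal A :=
  (Ring.jacobson (𝒜 0)).comap (GradedRing.projZeroRingHom' 𝒜)

/-- The `ℕ`-grading of `A` seen as a `ℤ`-grading: `Aₖ = 0` for `k < 0`. -/
def intGrading : ℤ → AddSubgroup A
  | Int.ofNat n => 𝒜 n
  | Int.negSucc _ => ⊥

end Ring

/-! ### Internal gradings by `ℤ` -/

section Internal

variable {M : Type*} [AddCommGroup M] {G : ℤ → AddSubgroup M}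

theorem isInternal_of_proj (p : ℤ → M →+ M) (h1 : ∀ k, ∀ m ∈ G k, p k m = m)
    (h0 : ∀ k l, k ≠ l → ∀ m ∈ G l, p k m = 0) (ht : ∀ m, m ∈ ⨆ k, G k) :
    DirectSum.IsInternal G := by
  have key : ∀ (k : ℤ) (x : ⨁ k, G k), p k (DirectSum.coeAddMonoidHom G x) = (x k : M) := by
    intro k x
    induction x using DirectSum.induction_on with
    | zero => simp
    | of l y =>
      rw [DirectSum.coeAddMonoidHom_of]
      by_cases h : k = l
      · subst h; rw [h1 _ _ y.2, DirectSum.of_eq_same]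
      · rw [h0 _ _ h _ y.2, DirectSum.of_eq_of_ne _ _ _ h]; rfl
    | add x y hx hy => rw [map_add, map_add, hx, hy]; rfl
  constructor
  · rw [injective_iff_map_eq_zero]
    intro x hx
    ext k
    rw [← key k x, hx, map_zero]; rfl
  · intro m
    have : (⨆ k, G k) ≤ (DirectSum.coeAddMonoidHom G).range :=
      iSup_le fun k y hy => ⟨DirectSum.of (fun k => G k) k ⟨y, hy⟩, by simp⟩
    exact this (ht m)

/-- The projection onto the component of degree `k` of an internal grading. -/
noncomputable def internalProj (h : DirectSum.IsInternal G) (k : ℤ) : M →+ M :=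
  ((G k).subtype.comp (DFinsupp.evalAddMonoidHom k : (⨁ k, G k) →+ G k)).comp
    (AddEquiv.ofBijective (DirectSum.coeAddMonoidHom G) h).symm.toAddMonoidHom

theorem internalProj_coe (h : DirectSum.IsInternal G) (k : ℤ) (x : ⨁ k, G k) :
    internalProj h k (DirectSum.coeAddMonoidHom G x) = (x k : M) := by
  have : (AddEquiv.ofBijective (DirectSum.coeAddMonoidHom G) h).symm
      (DirectSum.coeAddMonoidHom G x) = x := by
    rw [AddEquiv.symm_apply_eq]; rfl
  simp only [internalProj, AddMonoidHom.comp_apply, AddEquiv.coe_toAddMonoidHom, this]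
  rfl

theorem internalProj_mem (h : DirectSum.IsInternal G) (k : ℤ) (m : M) :
    internalProj h k m ∈ G k := by
  obtain ⟨x, rfl⟩ := h.2 m
  rw [internalProj_coe]; exact (x k).2

theorem internalProj_same (h : DirectSum.IsInternal G) (k : ℤ) (m : M) (hm : m ∈ G k) :
    internalProj h k m = m := by
  have := internalProj_coe h k (DirectSum.of (fun k => G k) k ⟨m, hm⟩)
  simpa using this

theorem internalProj_ne (h : DirectSum.IsInternal G) (k l : ℤ) (hkl : k ≠ l) (m : M)
    (hm : m ∈ G l) : internalProj h k m = 0 := by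
  have := internalProj_coe h k (DirectSum.of (fun k => G k) l ⟨m, hm⟩)
  rw [DirectSum.of_eq_of_ne _ _ _ hkl] at this
  simpa using this

theorem mem_iSup_of_internal (h : DirectSum.IsInternal G) (m : M) : m ∈ ⨆ k, G k := by
  obtain ⟨x, rfl⟩ := h.2 m
  induction x using DirectSum.induction_on with
  | zero => simp
  | of l y =>
    rw [DirectSum.coeAddMonoidHom_of]
    exact (le_iSup G l) y.2
  | add x y hx hy => rw [map_add]; exact add_mem hx hy

/-- A statement stable under sums holds for all elements if it holds for homogeneous ones. -/
theorem internal_induction (h : DirectSum.IsInternal G) {p : M → Prop}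
    (hom : ∀ k, ∀ m ∈ G k, p m) (zero : p 0) (add : ∀ x y, p x → p y → p (x + y)) (m : M) :
    p m :=
  AddSubgroup.iSup_induction G (C := p) (mem_iSup_of_internal h m) hom zero add

/-- Every element is the sum of its components. -/
theorem exists_sum_internalProj (h : DirectSum.IsInternal G) (m : M) :
    ∃ s : Finset ℤ, ∑ k ∈ s, internalProj h k m = m := by
  classical
  obtain ⟨x, rfl⟩ := h.2 m
  refine ⟨DFinsupp.support x, ?_⟩
  simp_rw [internalProj_coe]
  exact (DirectSum.coeAddMonoidHom_eq_dfinsuppSum _ x).symm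

end Internal

/-! ### Graded modules -/

/-- A (left, `ℤ`-)graded `A`-module: an `A`-module `M` with a direct sum decomposition
`M = ⨁ₖ Mₖ` such that `Aᵢ Mₖ ⊆ Mᵢ₊ₖ`. -/
structure GrMod {A : Type u} [Ring A] (𝒜 : ℕ → AddSubgroup A) where
  carrier : Type u
  [addCommGroup : AddCommGroup carrier]
  [module : Module A carrier]
  grading : ℤ → AddSubgroup carrier
  isInternal : DirectSum.IsInternal grading
  smul_mem : ∀ (i : ℕ) (k : ℤ) (a : A) (m : carrier),
    a ∈ 𝒜 i → m ∈ grading k → a • m ∈ grading (i + k)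

namespace GrMod

variable {A : Type u} [Ring A] {𝒜 : ℕ → AddSubgroup A}

attribute [instance] GrMod.addCommGroup GrMod.module

instance : CoeSort (GrMod 𝒜) (Type u) := ⟨GrMod.carrier⟩

/-- A morphism of graded modules: an `A`-linear map that preserves degrees. -/
@[ext]
structure Hom (M N : GrMod 𝒜) where
  toLin : M →ₗ[A] N
  map_mem : ∀ k, ∀ m ∈ M.grading k, toLin m ∈ N.grading k

instance : Category (GrMod 𝒜) where
  Hom := Hom
  id M := ⟨LinearMap.id, fun _ _ h => h⟩
  comp f g := ⟨g.toLin ∘ₗ f.toLin, fun k m h => g.map_mem k _ (f.map_mem k m h)⟩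

/-- The linear map underlying a morphism. -/
def lin {M N : GrMod 𝒜} (f : M ⟶ N) : M →ₗ[A] N := Hom.toLin f

/-- Constructor of morphisms. -/
def ofLin {M N : GrMod 𝒜} (f : M →ₗ[A] N) (h : ∀ k, ∀ m ∈ M.grading k, f m ∈ N.grading k) :
    M ⟶ N := Hom.mk f h

theorem lin_mem {M N : GrMod 𝒜} (f : M ⟶ N) (k : ℤ) (m : M) (h : m ∈ M.grading k) :
    lin f m ∈ N.grading k := Hom.map_mem f k m h

@[simp] theorem lin_ofLin {M N : GrMod 𝒜} (f : M →ₗ[A] N)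
    (h : ∀ k, ∀ m ∈ M.grading k, f m ∈ N.grading k) : lin (ofLin f h) = f := rfl

@[simp] theorem lin_id (M : GrMod 𝒜) : lin (𝟙 M) = LinearMap.id := rfl

@[simp] theorem lin_comp {M N L : GrMod 𝒜} (f : M ⟶ N) (g : N ⟶ L) :
    lin (f ≫ g) = lin g ∘ₗ lin f := rfl

theorem hom_ext {M N : GrMod 𝒜} {f g : M ⟶ N} (h : ∀ m, lin f m = lin g m) : f = g :=
  Hom.ext (LinearMap.ext h)

section Preadditive

variable {M N : GrMod 𝒜}

instance : Add (M ⟶ N) :=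
  ⟨fun f g => ofLin (lin f + lin g) fun k m h => add_mem (lin_mem f k m h) (lin_mem g k m h)⟩

instance : Zero (M ⟶ N) := ⟨ofLin 0 fun k _ _ => zero_mem (N.grading k)⟩

instance : Neg (M ⟶ N) := ⟨fun f => ofLin (-lin f) fun k m h => neg_mem (lin_mem f k m h)⟩

@[simp] theorem lin_add (f g : M ⟶ N) : lin (f + g) = lin f + lin g := rfl
@[simp] theorem lin_zero : lin (0 : M ⟶ N) = 0 := rfl
@[simp] theorem lin_neg (f : M ⟶ N) : lin (-f) = -lin f := rfl

instance : AddCommGroup (M ⟶ N) where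
  add_assoc _ _ _ := hom_ext fun _ => by simp [add_assoc]
  zero_add _ := hom_ext fun _ => by simp
  add_zero _ := hom_ext fun _ => by simp
  neg_add_cancel _ := hom_ext fun _ => by simp
  add_comm _ _ := hom_ext fun _ => by simp [add_comm]
  nsmul := nsmulRec
  zsmul := zsmulRec

end Preadditive

instance : Preadditive (GrMod 𝒜) where
  add_comp _ _ _ _ _ _ := hom_ext fun _ => by simp
  comp_add _ _ _ _ _ _ := hom_ext fun _ => by simp

/-- The projection of `M` onto its component of degree `k`. -/
noncomputable def proj (M : GrMod 𝒜) (k : ℤ) : M →+ M := internalProj M.isInternal k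

theorem lin_proj {M N : GrMod 𝒜} (f : M ⟶ N) (k : ℤ) (m : M) :
    lin f (M.proj k m) = N.proj k (lin f m) := by
  refine internal_induction M.isInternal
    (p := fun m => lin f (M.proj k m) = N.proj k (lin f m)) ?_ ?_ ?_ m
  · intro l m hm
    by_cases h : k = l
    · subst h
      rw [proj, proj, internalProj_same _ _ _ hm, internalProj_same _ _ _ (lin_mem f _ _ hm)]
    · rw [proj, proj, internalProj_ne _ _ _ h _ hm, internalProj_ne _ _ _ h _ (lin_mem f _ _ hm),
        map_zero]
  · simp
  · intro x y hx hy
    simp [hx, hy]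

/-- The graded submodule given by a homogeneous submodule. -/
def sub (M : GrMod 𝒜) (N : Submodule A M) (hN : ∀ k, ∀ m ∈ N, M.proj k m ∈ N) : GrMod 𝒜 where
  carrier := N
  grading k := (M.grading k).comap N.subtype.toAddMonoidHom
  isInternal := by
    refine isInternal_of_proj
      (fun k => ((M.proj k).comp N.subtype.toAddMonoidHom).codRestrict N.toAddSubgroup
        fun m => hN k m m.2) ?_ ?_ ?_
    · intro k m hm
      exact Subtype.ext (internalProj_same M.isInternal k m hm)
    · intro k l hkl m hm
      exact Subtype.ext (internalProj_ne M.isInternal k l hkl m hm)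
    · intro m
      obtain ⟨s, hs⟩ := exists_sum_internalProj M.isInternal (m : M)
      have : m = ∑ k ∈ s, (⟨M.proj k m, hN k m m.2⟩ : N) := by
        apply Subtype.ext
        rw [AddSubmonoidClass.coe_finsetSum]
        exact hs.symm
      rw [this]
      refine sum_mem fun k _ => AddSubgroup.mem_iSup_of_mem k ?_
      exact internalProj_mem M.isInternal k m
  smul_mem i k a m ha hm := M.smul_mem i k a m ha hm

/-- The graded quotient module by a homogeneous submodule; its component of degree `k` is the
image of `Mₖ`. -/
def quot (M : GrMod 𝒜) (N : Submodule A M) (hN : ∀ k, ∀ m ∈ N, M.proj k m ∈ N) : GrMod 𝒜 where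
  carrier := M ⧸ N
  grading k := (M.grading k).map N.mkQ.toAddMonoidHom
  isInternal := by
    refine isInternal_of_proj
      (fun k => QuotientAddGroup.map N.toAddSubgroup N.toAddSubgroup (M.proj k)
        fun m hm => hN k m hm) ?_ ?_ ?_
    · rintro k _ ⟨m, hm, rfl⟩
      exact congrArg N.mkQ (internalProj_same M.isInternal k m hm)
    · rintro k l hkl _ ⟨m, hm, rfl⟩
      exact (congrArg N.mkQ (internalProj_ne M.isInternal k l hkl m hm)).trans (map_zero _)
    · intro m
      obtain ⟨m, rfl⟩ := N.mkQ_surjective m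
      refine internal_induction M.isInternal (p := fun m => N.mkQ m ∈ _) ?_ ?_ ?_ m
      · intro k m hm
        exact AddSubgroup.mem_iSup_of_mem k ⟨m, hm, rfl⟩
      · rw [map_zero]; exact zero_mem _
      · intro x y hx hy
        rw [map_add]; exact add_mem hx hy
  smul_mem := by
    rintro i k a _ ha ⟨m, hm, rfl⟩
    exact ⟨a • m, M.smul_mem i k a m ha hm, rfl⟩

/-- The product of two graded modules. -/
def prod (M N : GrMod 𝒜) : GrMod 𝒜 where
  carrier := M × N
  grading k := (M.grading k).prod (N.grading k)
  isInternal := by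
    refine isInternal_of_proj (fun k => (M.proj k).prodMap (N.proj k)) ?_ ?_ ?_
    · intro k m hm
      exact Prod.ext (internalProj_same M.isInternal k _ hm.1)
        (internalProj_same N.isInternal k _ hm.2)
    · intro k l hkl m hm
      exact Prod.ext (internalProj_ne M.isInternal k l hkl _ hm.1)
        (internalProj_ne N.isInternal k l hkl _ hm.2)
    · rintro ⟨x, y⟩
      have hx : (x, (0 : N)) ∈ ⨆ k, (M.grading k).prod (N.grading k) := by
        refine internal_induction M.isInternal
          (p := fun x => (x, (0 : N)) ∈ ⨆ k, (M.grading k).prod (N.grading k)) ?_ ?_ ?_ x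
        · intro k m hm
          exact AddSubgroup.mem_iSup_of_mem k ⟨hm, zero_mem _⟩
        · exact zero_mem _
        · intro x y hx hy
          simpa using add_mem hx hy
      have hy : ((0 : M), y) ∈ ⨆ k, (M.grading k).prod (N.grading k) := by
        refine internal_induction N.isInternal
          (p := fun y => ((0 : M), y) ∈ ⨆ k, (M.grading k).prod (N.grading k)) ?_ ?_ ?_ y
        · intro k m hm
          exact AddSubgroup.mem_iSup_of_mem k ⟨zero_mem _, hm⟩
        · exact zero_mem _
        · intro x y hx hy
          simpa using add_mem hx hy
      simpa using add_mem hx hy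
  smul_mem i k a m ha hm :=
    ⟨M.smul_mem i k a m.1 ha hm.1, N.smul_mem i k a m.2 ha hm.2⟩

/-- The zero graded module. -/
def zeroObj (𝒜 : ℕ → AddSubgroup A) : GrMod 𝒜 where
  carrier := PUnit
  grading _ := ⊤
  isInternal := isInternal_of_proj (fun _ => 0) (fun _ _ _ => rfl) (fun _ _ _ _ _ => rfl)
    fun _ => AddSubgroup.mem_iSup_of_mem 0 trivial
  smul_mem _ _ _ _ _ _ := trivial

theorem ker_homogeneous {M N : GrMod 𝒜} (f : M ⟶ N) (k : ℤ) (m : M)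
    (hm : m ∈ LinearMap.ker (lin f)) : M.proj k m ∈ LinearMap.ker (lin f) := by
  rw [LinearMap.mem_ker] at hm ⊢
  rw [lin_proj, hm, map_zero]

theorem range_homogeneous {M N : GrMod 𝒜} (f : M ⟶ N) (k : ℤ) (m : N)
    (hm : m ∈ LinearMap.range (lin f)) : N.proj k m ∈ LinearMap.range (lin f) := by
  obtain ⟨x, rfl⟩ := hm
  exact ⟨M.proj k x, lin_proj f k x⟩

/-- The inclusion of a graded submodule. -/
def subι (M : GrMod 𝒜) (N : Submodule A M) (hN : ∀ k, ∀ m ∈ N, M.proj k m ∈ N) :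
    M.sub N hN ⟶ M := ofLin (M := M.sub N hN) N.subtype fun _ _ h => h

/-- The projection to a graded quotient. -/
def quotπ (M : GrMod 𝒜) (N : Submodule A M) (hN : ∀ k, ∀ m ∈ N, M.proj k m ∈ N) :
    M ⟶ M.quot N hN := ofLin (N := M.quot N hN) N.mkQ fun _ m h => ⟨m, h, rfl⟩

/-! #### The category of graded modules is abelian -/

section Abelian

variable {M N : GrMod 𝒜}

/-- The kernel of `f` is the submodule `ker f`. -/
def kernelIsLimit (f : M ⟶ N) :
    IsLimit (KernelFork.ofι (f := f) (M.subι (LinearMap.ker (lin f)) (ker_homogeneous f))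
      (hom_ext fun m => m.2)) :=
  KernelFork.IsLimit.ofι _ _
    (fun g hg => ofLin (N := M.sub (LinearMap.ker (lin f)) (ker_homogeneous f))
      (LinearMap.codRestrict (LinearMap.ker (lin f)) (lin g)
        fun m => LinearMap.congr_fun (congrArg lin hg) m)
      fun k m h => lin_mem g k m h)
    (fun _ _ => rfl)
    (fun _ _ _ hb => hom_ext fun m => Subtype.ext (LinearMap.congr_fun (congrArg lin hb) m))

/-- The cokernel of `f` is the quotient module by `range f`. -/
def cokernelIsColimit (f : M ⟶ N) :
    IsColimit (CokernelCofork.ofπ (f := f)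
      (N.quotπ (LinearMap.range (lin f)) (range_homogeneous f))
      (hom_ext fun m => (Submodule.Quotient.mk_eq_zero _).2 ⟨m, rfl⟩)) :=
  CokernelCofork.IsColimit.ofπ _ _
    (fun {Z} g hg => ofLin (M := N.quot (LinearMap.range (lin f)) (range_homogeneous f)) (N := Z)
      ((LinearMap.range (lin f)).liftQ (lin g) (by
        rintro _ ⟨m, rfl⟩
        exact LinearMap.congr_fun (congrArg lin hg) m))
      (by
        rintro k _ ⟨m, h, rfl⟩
        exact lin_mem g k m h))
    (fun _ _ => rfl)
    (fun _ _ _ hb => hom_ext fun m => by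
      obtain ⟨m, rfl⟩ := Submodule.mkQ_surjective _ m
      exact LinearMap.congr_fun (congrArg lin hb) m)

instance : HasKernels (GrMod 𝒜) := ⟨fun f => ⟨⟨_, kernelIsLimit f⟩⟩⟩

instance : HasCokernels (GrMod 𝒜) := ⟨fun f => ⟨⟨_, cokernelIsColimit f⟩⟩⟩

theorem injective_of_mono (f : M ⟶ N) [Mono f] : Function.Injective (lin f) := by
  rw [injective_iff_map_eq_zero]
  intro m hm
  have h : M.subι (LinearMap.ker (lin f)) (ker_homogeneous f) = 0 := by
    rw [← cancel_mono f]
    exact hom_ext fun x => x.2.trans (by simp)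
  exact LinearMap.congr_fun (congrArg lin h) ⟨m, hm⟩

theorem surjective_of_epi (f : M ⟶ N) [Epi f] : Function.Surjective (lin f) := by
  intro n
  have h : N.quotπ (LinearMap.range (lin f)) (range_homogeneous f) = 0 := by
    rw [← cancel_epi f]
    exact hom_ext fun x => (Submodule.Quotient.mk_eq_zero _).2 ⟨x, rfl⟩
  exact (Submodule.Quotient.mk_eq_zero _).1 (LinearMap.congr_fun (congrArg lin h) n)

/-- The inverse of an injective morphism on its range preserves degrees. -/
theorem mem_of_injective (f : M ⟶ N) (hf : Function.Injective (lin f)) (k : ℤ) (m : M)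
    (h : lin f m ∈ N.grading k) : m ∈ M.grading k := by
  have : lin f (M.proj k m) = lin f m := by
    rw [lin_proj]; exact internalProj_same _ _ _ h
  rw [← hf this]
  exact internalProj_mem _ _ _

/-- Homogeneous elements lift to homogeneous elements along surjections. -/
theorem exists_mem_of_surjective (f : M ⟶ N) (hf : Function.Surjective (lin f)) (k : ℤ) (n : N)
    (h : n ∈ N.grading k) : ∃ m ∈ M.grading k, lin f m = n := by
  obtain ⟨m, rfl⟩ := hf n
  refine ⟨M.proj k m, internalProj_mem _ _ _, ?_⟩
  rw [lin_proj]; exact internalProj_same _ _ _ h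

/-- A monomorphism is the kernel of its cokernel. -/
theorem normalMono (f : M ⟶ N) [Mono f] : Nonempty (NormalMono f) := ⟨{
  Z := N.quot (LinearMap.range (lin f)) (range_homogeneous f)
  g := N.quotπ (LinearMap.range (lin f)) (range_homogeneous f)
  w := hom_ext fun m => (Submodule.Quotient.mk_eq_zero _).2 ⟨m, rfl⟩
  isLimit := by
    have hr : ∀ {Z : GrMod 𝒜} (g : Z ⟶ N),
        g ≫ N.quotπ (LinearMap.range (lin f)) (range_homogeneous f) = 0 →
        ∀ z, lin g z ∈ LinearMap.range (lin f) := fun g hg z =>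
      (Submodule.Quotient.mk_eq_zero _).1 (LinearMap.congr_fun (congrArg lin hg) z)
    have hl : ∀ {Z : GrMod 𝒜} (g : Z ⟶ N)
        (hg : g ≫ N.quotπ (LinearMap.range (lin f)) (range_homogeneous f) = 0) (z : Z),
        lin f (((LinearEquiv.ofInjective (lin f) (injective_of_mono f)).symm.toLinearMap ∘ₗ
          LinearMap.codRestrict _ (lin g) (hr g hg)) z) = lin g z := fun g hg z =>
      congrArg Subtype.val ((LinearEquiv.ofInjective (lin f) (injective_of_mono f)).apply_symm_apply
        ⟨lin g z, hr g hg z⟩)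
    exact KernelFork.IsLimit.ofι _ _
      (fun {Z} g hg => ofLin (M := Z) (N := M)
        ((LinearEquiv.ofInjective (lin f) (injective_of_mono f)).symm.toLinearMap ∘ₗ
          LinearMap.codRestrict _ (lin g) (hr g hg))
        (fun k z h => mem_of_injective f (injective_of_mono f) k _ (by
          rw [hl g hg]; exact lin_mem g k z h)))
      (fun g hg => hom_ext fun z => hl g hg z)
      (fun g hg b hb => (cancel_mono f).1 (hb.trans (hom_ext fun z => (hl g hg z).symm))) }⟩

/-- An epimorphism is the cokernel of its kernel. -/
theorem normalEpi (f : M ⟶ N) [Epi f] : Nonempty (NormalEpi f) := ⟨{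
  W := M.sub (LinearMap.ker (lin f)) (ker_homogeneous f)
  g := M.subι (LinearMap.ker (lin f)) (ker_homogeneous f)
  w := hom_ext fun m => m.2
  isColimit := by
    have hk : ∀ {Z : GrMod 𝒜} (g : M ⟶ Z),
        M.subι (LinearMap.ker (lin f)) (ker_homogeneous f) ≫ g = 0 →
        LinearMap.ker (lin f) ≤ LinearMap.ker (lin g) := fun g hg m hm =>
      LinearMap.congr_fun (congrArg lin hg) ⟨m, hm⟩
    have hl : ∀ {Z : GrMod 𝒜} (g : M ⟶ Z)
        (hg : M.subι (LinearMap.ker (lin f)) (ker_homogeneous f) ≫ g = 0) (m : M),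
        ((LinearMap.ker (lin f)).liftQ (lin g) (hk g hg) ∘ₗ
          ((lin f).quotKerEquivOfSurjective (surjective_of_epi f)).symm.toLinearMap) (lin f m) =
          lin g m := fun g hg m => by
      have : ((lin f).quotKerEquivOfSurjective (surjective_of_epi f)).symm (lin f m) =
          (LinearMap.ker (lin f)).mkQ m := by
        rw [LinearEquiv.symm_apply_eq]; rfl
      rw [LinearMap.comp_apply, LinearEquiv.coe_coe, this]
      rfl
    exact CokernelCofork.IsColimit.ofπ _ _
      (fun {Z} g hg => ofLin (M := N) (N := Z)
        ((LinearMap.ker (lin f)).liftQ (lin g) (hk g hg) ∘ₗ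
          ((lin f).quotKerEquivOfSurjective (surjective_of_epi f)).symm.toLinearMap)
        (fun k n h => by
          obtain ⟨m, hm, rfl⟩ := exists_mem_of_surjective f (surjective_of_epi f) k n h
          rw [hl g hg]; exact lin_mem g k m hm))
      (fun g hg => hom_ext fun z => hl g hg z)
      (fun g hg b hb => (cancel_epi f).1 (hb.trans (hom_ext fun z => (hl g hg z).symm))) }⟩

instance : HasZeroObject (GrMod 𝒜) :=
  ⟨⟨zeroObj 𝒜, fun _ => ⟨⟨⟨0⟩, fun f => hom_ext fun m =>
      (congrArg (lin f) (Subsingleton.elim (α := PUnit) m 0)).trans (map_zero (lin f))⟩⟩,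
    fun _ => ⟨⟨⟨0⟩, fun _ => hom_ext fun _ => Subsingleton.elim (α := PUnit) _ _⟩⟩⟩⟩

/-- The biproduct of `M` and `N`. -/
def prodBicone (M N : GrMod 𝒜) : BinaryBicone M N where
  pt := prod M N
  fst := ofLin (M := prod M N) (LinearMap.fst A M N) fun _ _ h => h.1
  snd := ofLin (M := prod M N) (LinearMap.snd A M N) fun _ _ h => h.2
  inl := ofLin (N := prod M N) (LinearMap.inl A M N) fun _ _ h => ⟨h, zero_mem _⟩
  inr := ofLin (N := prod M N) (LinearMap.inr A M N) fun _ _ h => ⟨zero_mem _, h⟩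
  inl_fst := rfl
  inl_snd := rfl
  inr_fst := rfl
  inr_snd := rfl

instance : HasBinaryBiproducts (GrMod 𝒜) :=
  ⟨fun M N => hasBinaryBiproduct_of_total (prodBicone M N) (hom_ext fun (m : M × N) => by
    change ((m.1, (0 : N)) + ((0 : M), m.2) : M × N) = m
    simp)⟩

instance : HasFiniteProducts (GrMod 𝒜) := hasFiniteProducts_of_has_binary_and_terminal

instance : Abelian (GrMod 𝒜) where
  normalMonoOfMono f _ := normalMono f
  normalEpiOfEpi f _ := normalEpi f

end Abelian

instance : HasExt.{u + 1} (GrMod 𝒜) := HasExt.standard _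

/-! #### Shifts -/

/-- The shift `M(l)`: the same module, with `M(l)ₖ = Mₖ₊ₗ`. -/
def shift (M : GrMod 𝒜) (l : ℤ) : GrMod 𝒜 where
  carrier := M
  grading k := M.grading (k + l)
  isInternal := by
    refine isInternal_of_proj (fun k => M.proj (k + l)) ?_ ?_ ?_
    · intro k m hm
      exact internalProj_same M.isInternal _ _ hm
    · intro k k' h m hm
      exact internalProj_ne M.isInternal _ _ (by simpa using h) _ hm
    · intro m
      refine internal_induction M.isInternal (p := fun m => m ∈ ⨆ k, M.grading (k + l)) ?_ ?_ ?_ m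
      · intro k m hm
        refine AddSubgroup.mem_iSup_of_mem (k - l) ?_
        rwa [sub_add_cancel]
      · exact zero_mem _
      · intro x y hx hy
        exact add_mem hx hy
  smul_mem i k a m ha hm := by
    have := M.smul_mem i (k + l) a m ha hm
    rwa [← add_assoc] at this

/-- The shift functor. -/
def shiftFunctor (𝒜 : ℕ → AddSubgroup A) (l : ℤ) : GrMod 𝒜 ⥤ GrMod 𝒜 where
  obj M := M.shift l
  map {M N} f := ofLin (M := M.shift l) (N := N.shift l) (lin (M := M) (N := N) f)
    fun k m h => lin_mem (M := M) (N := N) f (k + l) m h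

/-- The identity map `M(l)(k) → M(k + l)`. -/
def shiftShift (M : GrMod 𝒜) (k l : ℤ) :
    (shiftFunctor 𝒜 k).obj ((shiftFunctor 𝒜 l).obj M) ⟶ (shiftFunctor 𝒜 (k + l)).obj M :=
  ofLin (M := (M.shift l).shift k) (N := M.shift (k + l)) LinearMap.id
    fun i m (hm : m ∈ M.grading _) => by
      change m ∈ M.grading _
      rwa [← add_assoc]

instance (l : ℤ) : (shiftFunctor 𝒜 l).Additive where
  map_add := rfl

instance (l : ℤ) : (shiftFunctor 𝒜 l).IsEquivalence where
  faithful := ⟨fun {M N} f g h => hom_ext fun m =>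
    LinearMap.congr_fun (congrArg (lin (M := M.shift l) (N := N.shift l)) h) m⟩
  full := ⟨fun {M N} g => ⟨ofLin (M := M) (N := N) (lin (M := M.shift l) (N := N.shift l) g)
    fun k m h => by
      have := lin_mem (M := M.shift l) (N := N.shift l) g (k - l) m
        (by change m ∈ M.grading _; rwa [sub_add_cancel])
      change _ ∈ N.grading _ at this
      rwa [sub_add_cancel] at this, rfl⟩⟩
  essSurj := ⟨fun M => ⟨M.shift (-l), ⟨{
    hom := ofLin (M := (M.shift (-l)).shift l) (N := M) LinearMap.id
      fun k m (h : m ∈ M.grading _) => by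
        rw [add_neg_cancel_right] at h; exact h
    inv := ofLin (M := M) (N := (M.shift (-l)).shift l) LinearMap.id fun k m h => by
      change m ∈ M.grading _
      rwa [add_neg_cancel_right]
    hom_inv_id := rfl
    inv_hom_id := rfl }⟩⟩⟩

/-! ### Graded Ext groups and Yoneda products -/

/-- The graded Ext group `Extⁿ(M, N) = ⨁ₗ Extⁿ_{Gr A}(M, N(l))`, where `Gr A` is the category of
graded `A`-modules and degree-preserving maps. -/
abbrev GExt (M N : GrMod 𝒜) (n : ℕ) : Type (u + 1) :=
  ⨁ l : ℤ, Abelian.Ext.{u + 1} M ((shiftFunctor 𝒜 l).obj N) n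

/-- The Yoneda product on homogeneous elements: for `α ∈ Extⁱ(X, Y(a))` and `β ∈ Extʲ(Y, Z(b))`,
it is the composite of `α` with `β(a) ∈ Extʲ(Y(a), Z(b)(a))`, where `Z(b)(a) = Z(a + b)`. -/
noncomputable def yonedaHom {X Y Z : GrMod 𝒜} {i j n : ℕ} (h : i + j = n) (a b : ℤ)
    (β : Abelian.Ext.{u + 1} Y ((shiftFunctor 𝒜 b).obj Z) j) (α : Abelian.Ext.{u + 1} X ((shiftFunctor 𝒜 a).obj Y) i) :
    Abelian.Ext.{u + 1} X ((shiftFunctor 𝒜 (a + b)).obj Z) n :=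
  (α.comp (β.mapExactFunctor (shiftFunctor 𝒜 a)) h).comp
    (Abelian.Ext.mk₀ (Z.shiftShift a b)) (add_zero n)

/-- The homogeneous Yoneda product as a biadditive map with values in the graded Ext group. -/
noncomputable def yonedaHomAdd {X Y Z : GrMod 𝒜} {i j n : ℕ} (h : i + j = n) (a b : ℤ) :
    Abelian.Ext.{u + 1} Y ((shiftFunctor 𝒜 b).obj Z) j →+
      Abelian.Ext.{u + 1} X ((shiftFunctor 𝒜 a).obj Y) i →+ GExt X Z n :=
  AddMonoidHom.mk' (fun β => AddMonoidHom.mk'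
      (fun α => DirectSum.of
        (fun l => Abelian.Ext.{u + 1} X ((shiftFunctor 𝒜 l).obj Z) n) (a + b) (yonedaHom h a b β α))
      (fun α α' => by simp only [yonedaHom, Abelian.Ext.add_comp, map_add]))
    (fun β β' => AddMonoidHom.ext fun α => by
      simp [yonedaHom, Abelian.Ext.add_comp])

/-- The Yoneda product `(β, α) ↦ β · α`, `Extʲ(Y, Z) × Extⁱ(X, Y) → Extⁿ(X, Z)`, `n = i + j`, of
graded Ext groups: the biadditive extension of the product of homogeneous elements. -/
noncomputable def yoneda {X Y Z : GrMod 𝒜} {i j n : ℕ} (h : i + j = n) :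
    GExt Y Z j →+ GExt X Y i →+ GExt X Z n :=
  DirectSum.toAddMonoid fun b => AddMonoidHom.flip <|
    DirectSum.toAddMonoid fun a => AddMonoidHom.flip (yonedaHomAdd h a b)

/-- The product `Extʲ(Y, Z) · Extⁱ(X, Y)`: the subgroup of `Extⁿ(X, Z)`, `n = i + j`, of all finite
sums of Yoneda products `β · α`. -/
noncomputable def yonedaSpan (X Y Z : GrMod 𝒜) (j i n : ℕ) (h : i + j = n) :
    AddSubgroup (GExt X Z n) :=
  AddSubgroup.closure {γ | ∃ (β : GExt Y Z j) (α : GExt X Y i), γ = yoneda h β α}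

/-- The Yoneda Ext ring `⨁ₙ Extⁿ(S, S)` is generated by `Ext¹(S, S)` over `Hom(S, S)`: the only
graded subring `⨁ₙ Tₙ` that contains `Ext⁰(S, S) = Hom(S, S)` and `Ext¹(S, S)` is the whole
ring. -/
def ExtRingGeneratedByDegreeOne (S : GrMod 𝒜) : Prop :=
  ∀ T : (n : ℕ) → AddSubgroup (GExt S S n), T 0 = ⊤ → T 1 = ⊤ →
    (∀ (i j n : ℕ) (h : i + j = n), ∀ β ∈ T j, ∀ α ∈ T i, yoneda h β α ∈ T n) →
    ∀ n, T n = ⊤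

/-! ### Graded projective resolutions -/

/-- A graded projective resolution `⋯ → P₁ → P₀ → M → 0`; `ε` is `d₀ : P₀ → M` and `d n` is
`dₙ₊₁ : Pₙ₊₁ → Pₙ`. -/
structure GrProjRes (M : GrMod 𝒜) where
  P : ℕ → GrMod 𝒜
  projective : ∀ n, Projective (P n)
  ε : P 0 ⟶ M
  d : ∀ n, P (n + 1) ⟶ P n
  ε_surjective : Function.Surjective (lin ε)
  exact_zero : LinearMap.range (lin (d 0)) = LinearMap.ker (lin ε)
  exact_succ : ∀ n, LinearMap.range (lin (d (n + 1))) = LinearMap.ker (lin (d n))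

/-- `Ker dₙ ⊆ Pₙ`. -/
def GrProjRes.kerD {M : GrMod 𝒜} (R : GrProjRes M) : (n : ℕ) → Submodule A (R.P n)
  | 0 => LinearMap.ker (lin R.ε)
  | n + 1 => LinearMap.ker (lin (R.d n))

/-- `M` is bounded below. -/
def IsBoundedBelow (M : GrMod 𝒜) : Prop := ∃ l : ℤ, ∀ k < l, M.grading k = ⊥

section Koszul

variable [GradedRing 𝒜]

/-- The resolution is minimal: `Im dₙ₊₁ ⊆ J Pₙ` for all `n ≥ 0`. -/
def GrProjRes.IsMinimal {M : GrMod 𝒜} (R : GrProjRes M) : Prop :=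
  ∀ n, LinearMap.range (lin (R.d n)) ≤ gradedRadical 𝒜 • (⊤ : Submodule A (R.P n))

/-- `M` is quasi-Koszul: it has a minimal graded projective resolution, and in its (essentially
unique) minimal graded projective resolution, `J Ker dₙ = Ker dₙ ∩ J² Pₙ` for all `n ≥ 0`. -/
def IsQuasiKoszul (M : GrMod 𝒜) : Prop :=
  (∃ R : GrProjRes M, R.IsMinimal) ∧
    ∀ R : GrProjRes M, R.IsMinimal → ∀ n,
      gradedRadical 𝒜 • R.kerD n =
        R.kerD n ⊓ gradedRadical 𝒜 • gradedRadical 𝒜 • (⊤ : Submodule A (R.P n))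

/-- `M` is left finite: every component `Mₖ` is a finitely generated `A₀`-module. -/
def IsLeftFinite (M : GrMod 𝒜) : Prop := ∀ k, IsFGOverDegreeZero 𝒜 (M.grading k)

end Koszul

/-! ### The graded modules `A` and `S = A / J` -/

section Regular

variable (𝒜) [GradedRing 𝒜]

theorem intGrading_isInternal : DirectSum.IsInternal (intGrading 𝒜) := by
  refine isInternal_of_proj (fun
    | Int.ofNat n => GradedRing.proj 𝒜 n
    | Int.negSucc _ => 0) ?_ ?_ ?_
  · rintro (k | k) m hm
    · exact DirectSum.decompose_of_mem_same 𝒜 hm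
    · exact ((AddSubgroup.mem_bot).1 hm).symm
  · rintro (k | k) (l | l) hkl m hm
    · exact DirectSum.decompose_of_mem_ne 𝒜 hm (fun h => hkl (by rw [h]))
    · rw [(AddSubgroup.mem_bot).1 hm, map_zero]
    · rfl
    · rfl
  · intro m
    classical
    rw [← DirectSum.sum_support_decompose 𝒜 m]
    exact sum_mem fun k _ => AddSubgroup.mem_iSup_of_mem (Int.ofNat k) (SetLike.coe_mem _)

/-- `A` as a graded module over itself. -/
def regular : GrMod 𝒜 where
  carrier := A
  grading := intGrading 𝒜
  isInternal := intGrading_isInternal 𝒜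
  smul_mem := by
    rintro i (k | k) a m ha hm
    · exact SetLike.mul_mem_graded (A := 𝒜) ha hm
    · rw [(AddSubgroup.mem_bot).1 hm, smul_zero]; exact zero_mem _

theorem gradedRadical_homogeneous (k : ℤ) (a : A) (ha : a ∈ gradedRadical 𝒜) :
    internalProj (intGrading_isInternal 𝒜) k a ∈ gradedRadical 𝒜 := by
  have hne : ∀ l : ℤ, l ≠ 0 → ∀ x ∈ intGrading 𝒜 l, GradedRing.projZeroRingHom' 𝒜 x = 0 := by
    rintro (l | l) hl x hx
    · exact Subtype.ext (DirectSum.decompose_of_mem_ne 𝒜 hx (fun h => hl (by rw [h]; rfl)))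
    · rw [(AddSubgroup.mem_bot).1 hx, map_zero]
  rw [gradedRadical, Ideal.mem_comap] at ha ⊢
  by_cases hk : k = 0
  · subst hk
    have : ∀ x : A, GradedRing.projZeroRingHom' 𝒜
        (internalProj (intGrading_isInternal 𝒜) 0 x) = GradedRing.projZeroRingHom' 𝒜 x := by
      refine internal_induction (intGrading_isInternal 𝒜) ?_ ?_ ?_
      · intro l x hx
        by_cases hl : 0 = l
        · subst hl
          rw [internalProj_same _ _ _ hx]
        · rw [hne l (Ne.symm hl) x hx, internalProj_ne _ _ _ hl _ hx, map_zero]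
      · rw [map_zero]
      · intro x y hx hy
        rw [map_add, map_add, map_add, hx, hy]
    rw [this]; exact ha
  · rw [hne k hk _ (internalProj_mem _ k a)]
    exact zero_mem _

/-- The graded `A`-module `S = A / J`. -/
noncomputable def simpleTop : GrMod 𝒜 := (regular 𝒜).quot (gradedRadical 𝒜) (gradedRadical_homogeneous 𝒜)

end Regular

end GrMod

/-!
In a minimal resolution the syzygy `Ωⁿ⁺¹ M` lies in `J Pₙ`, so morphisms `Pₙ → S(l)` vanish on it
and `Extⁿ(M, S) = ⨁ₗ Hom(Ωⁿ M, S(l))`. Every class in `Ext¹(S, S(b))` is a pushout of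
`0 → J → A → S → 0` along a morphism `J → S(b)`. Hence `Ext¹(S, S) · Extⁿ(M, S)` is spanned by the
composites `Ωⁿ⁺¹ M → J(a) → S(a + b)` whose first morphism is the restriction of some `Pₙ → A(a)`.
These kill `Ωⁿ⁺¹ M ∩ J² Pₙ`, and since every element of `J Pₙ` is the sum of its coordinates in a
dual basis of `Pₙ`, all morphisms `Ωⁿ⁺¹ M → S(l)` which extend to `J Pₙ` are sums of such
composites. As `A ⧸ J` is semisimple, the morphisms `Ωⁿ⁺¹ M → S(l)` detect the elements outside
`J Ωⁿ⁺¹ M`, and they all extend to `J Pₙ` if `Ωⁿ⁺¹ M ∩ J² Pₙ = J Ωⁿ⁺¹ M`. So the latter condition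
says exactly that the products exhaust `Extⁿ⁺¹(M, S)`.

Minimal resolutions exist because idempotents lift modulo the radical of `A₀` and Nakayama's lemma
applies degree by degree. For `M = S`, the associativity of the Yoneda product turns generation by
`Ext¹(S, S)` into `Ext¹(S, S) · Extⁿ(S, S) = Extⁿ⁺¹(S, S)` for all `n`.
-/

section Semisimple

variable {R W : Type*} [Ring R] [IsSemisimpleRing R] [AddCommGroup W] [Module R W]

theorem exists_isIdempotentElem_smul_eq_zero_iff (x : W) :
    ∃ f : R, IsIdempotentElem f ∧ ∀ c : R, c • x = 0 ↔ c * f = 0 := by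
  obtain ⟨e, he, hker⟩ := IsSemisimpleRing.ideal_eq_span_idempotent
    (LinearMap.ker (LinearMap.toSpanSingleton R W x))
  refine ⟨1 - e, he.one_sub, fun c => ?_⟩
  calc c • x = 0 ↔ c ∈ Ideal.span {e} := by rw [← hker]; simp
    _ ↔ c * e = c := Ideal.mem_span_singleton'.trans
      ⟨fun ⟨b, hb⟩ => by rw [← hb, mul_assoc, he.eq], fun h => ⟨c, h⟩⟩
    _ ↔ c * (1 - e) = 0 := by rw [mul_sub, mul_one, sub_eq_zero, eq_comm]

theorem exists_idempotent_decomposition [Module.Finite R W] :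
    ∃ (r : ℕ) (w : Fin r → W) (f : Fin r → R), (∀ i, IsIdempotentElem (f i)) ∧
      (∀ i, f i • w i = w i) ∧ Submodule.span R (Set.range w) = ⊤ ∧
      ∀ c : Fin r → R, ∑ i, c i • w i = 0 → ∀ i, c i * f i = 0 := by
  obtain ⟨r, S, φ, hS⟩ := IsSemisimpleModule.exists_linearEquiv_fin_dfinsupp R W
  have hgen : ∀ i, ∃ t : S i, ∀ s : S i, ∃ c : R, c • t = s := fun i => by
    have := IsSimpleModule.nontrivial R (S i)
    obtain ⟨t, ht⟩ := exists_ne (0 : S i)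
    exact ⟨t, IsSimpleModule.toSpanSingleton_surjective R ht⟩
  choose t ht using hgen
  choose f hf hft using fun i => exists_isIdempotentElem_smul_eq_zero_iff (R := R) (t i)
  have hcoord (c : Fin r → R) (j : Fin r) :
      φ (∑ i, c i • φ.symm (DFinsupp.single i (t i))) j = c j • t j := by
    simp only [map_sum, map_smul, LinearEquiv.apply_symm_apply]
    rw [DFinsupp.finsetSum_apply, Finset.sum_eq_single j] <;>
      simp +contextual [DFinsupp.single_apply]
  have hfix (i : Fin r) : f i • t i = t i := by
    have : (1 - f i) • t i = 0 := (hft i _).2 (hf i).one_sub_mul_self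
    rwa [sub_smul, one_smul, sub_eq_zero, eq_comm] at this
  refine ⟨r, fun i => φ.symm (DFinsupp.single i (t i)), f, hf, fun i => ?_, ?_, fun c hc i => ?_⟩
  · rw [← map_smul, ← DFinsupp.single_smul, hfix]
  · refine eq_top_iff.2 fun x _ => (Submodule.mem_span_range_iff_exists_fun R).2 ?_
    choose c hc using fun i => ht i (φ x i)
    exact ⟨c, φ.injective (DFinsupp.ext fun j => by rw [hcoord, hc])⟩
  · rw [← hft, ← hcoord, hc]
    simp

end Semisimple

section IdealQuotient

variable {A N P W : Type*} [Ring A] [AddCommGroup N] [Module A N] [AddCommGroup P] [Module A P]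
  [AddCommGroup W] [Module A W]

theorem map_eq_zero_of_mem_smul_top {I : Ideal A} (hW : ∀ a ∈ I, ∀ w : W, a • w = 0)
    (φ : N →ₗ[A] W) {x : N} (hx : x ∈ I • (⊤ : Submodule A N)) : φ x = 0 :=
  (Submodule.smul_le.2 fun a ha y _ => (map_smul φ a y).trans (hW a ha _) :
    I • ⊤ ≤ LinearMap.ker φ) hx

theorem map_mem_of_mem_smul_top {I : Ideal A} [I.IsTwoSided] (φ : N →ₗ[A] A) {x : N}
    (hx : x ∈ I • (⊤ : Submodule A N)) : φ x ∈ I :=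
  (Submodule.smul_le.2 fun a ha y _ => by
    rw [Submodule.mem_comap, map_smul]
    exact I.mul_mem_right _ ha : I • ⊤ ≤ Submodule.comap φ I) hx

theorem exists_linearMap_quotient_apply_ne_zero (I : Ideal A)
    [I.IsTwoSided] [IsSemisimpleRing (A ⧸ I)] {x : N}
    (hx : x ∉ I • (⊤ : Submodule A N)) : ∃ φ : N →ₗ[A] A ⧸ I, φ x ≠ 0 := by
  have := Module.projective_of_isSemisimpleRing (A ⧸ I) (N ⧸ I • (⊤ : Submodule A N))
  obtain ⟨φ, hφ⟩ := Module.Projective.exists_dual_ne_zero (A ⧸ I)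
    (mt (Submodule.Quotient.mk_eq_zero _).1 hx)
  exact ⟨φ.restrictScalars A ∘ₗ (I • (⊤ : Submodule A N)).mkQ, hφ⟩

theorem exists_extension_of_inf_smul_le (I : Ideal A) [I.IsTwoSided] [IsSemisimpleRing (A ⧸ I)]
    (hW : ∀ a ∈ I, ∀ w : W, a • w = 0) {L Q : Submodule A P} (hLQ : L ≤ Q)
    (h : L ⊓ I • Q ≤ I • L) (u : L →ₗ[A] W) :
    ∃ φ : Q →ₗ[A] W, φ ∘ₗ Submodule.inclusion hLQ = u := by
  have hss : IsSemisimpleModule A (Q ⧸ I • (⊤ : Submodule A Q)) :=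
    (Module.isTorsionBySet_quotient_ideal_smul Q I).isSemisimpleModule_iff.1 inferInstance
  let ψ : L →ₗ[A] Q ⧸ I • (⊤ : Submodule A Q) := Submodule.mkQ _ ∘ₗ Submodule.inclusion hLQ
  have hker : LinearMap.ker ψ ≤ LinearMap.ker u := fun x hx =>
    map_eq_zero_of_mem_smul_top hW u <| (Submodule.mem_smul_top_iff I L x).2 <| h ⟨x.2,
      (Submodule.mem_smul_top_iff I Q _).1 ((Submodule.Quotient.mk_eq_zero _).1 hx)⟩
  obtain ⟨φ, hφ⟩ := IsSemisimpleModule.extension_property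
    ((LinearMap.ker ψ).liftQ ψ le_rfl)
    (LinearMap.ker_eq_bot.1 (Submodule.ker_liftQ_eq_bot _ _ _ le_rfl))
    ((LinearMap.ker ψ).liftQ u hker)
  exact ⟨φ ∘ₗ Submodule.mkQ _, LinearMap.ext fun x =>
    LinearMap.congr_fun hφ ((LinearMap.ker ψ).mkQ x)⟩

end IdealQuotient

theorem IsSemiperfectRing.exists_idempotent_generators {R N : Type*} [Ring R]
    (hR : IsSemiperfectRing R) [AddCommGroup N] [Module R N] [Module.Finite R N]
    {L : Submodule R N} (hL : Ring.jacobson R • ⊤ ≤ L) :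
    ∃ (r : ℕ) (m : Fin r → N) (e : Fin r → R), (∀ i, IsIdempotentElem (e i)) ∧
      (∀ i, e i • m i = m i) ∧ L ⊔ Submodule.span R (Set.range m) = ⊤ ∧
      ∀ c : Fin r → R, ∑ i, c i • m i ∈ L → ∀ i, c i * e i ∈ Ring.jacobson R := by
  obtain ⟨hss, hlift⟩ := hR
  have htors : Module.IsTorsionBySet R (N ⧸ L) (Ring.jacobson R : Set R) := by
    rintro ⟨y⟩ ⟨a, ha⟩
    exact (Submodule.Quotient.mk_eq_zero L).2 (hL (Submodule.smul_mem_smul ha trivial))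
  let _ := htors.module
  have : IsScalarTower R (R ⧸ Ring.jacobson R) (N ⧸ L) := htors.isScalarTower
  have : Module.Finite (R ⧸ Ring.jacobson R) (N ⧸ L) :=
    Module.Finite.of_restrictScalars_finite R _ _
  obtain ⟨r, w, f, hf, hfw, hspan, hind⟩ :=
    exists_idempotent_decomposition (R := R ⧸ Ring.jacobson R) (W := N ⧸ L)
  choose m hm using fun i => L.mkQ_surjective (w i)
  choose x hx using fun i => Ideal.Quotient.mk_surjective (f i)
  choose e he hex using fun i => hlift (x i)
    (Ideal.Quotient.eq.1 (by rw [map_mul, hx, (hf i).eq]))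
  have hef (i : Fin r) : Ideal.Quotient.mk (Ring.jacobson R) (e i) = f i :=
    (Ideal.Quotient.eq.2 (hex i)).trans (hx i)
  have hsmul (a : R) (y : N ⧸ L) : Ideal.Quotient.mk (Ring.jacobson R) a • y = a • y := rfl
  have hem (i : Fin r) : L.mkQ (e i • m i) = w i := by
    rw [map_smul, hm, ← hsmul, hef, hfw]
  refine ⟨r, fun i => e i • m i, e, he, fun i => ?_, ?_, fun c hc i => ?_⟩
  · rw [← mul_smul, (he i).eq]
  · refine (Submodule.map_mkQ_eq_top _ _).1 (eq_top_iff.2 fun y _ => ?_)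
    obtain ⟨c, rfl⟩ := (Submodule.mem_span_range_iff_exists_fun _).1
      (hspan ▸ Submodule.mem_top : y ∈ Submodule.span _ (Set.range w))
    choose b hb using fun i => Ideal.Quotient.mk_surjective (c i)
    refine ⟨∑ i, b i • e i • m i, sum_mem fun i _ => Submodule.smul_mem _ _
      (Submodule.subset_span ⟨i, rfl⟩), ?_⟩
    simp only [map_sum, map_smul L.mkQ, ← hb, hsmul, ← hem]
  · have hsum : ∑ i, Ideal.Quotient.mk (Ring.jacobson R) (c i) • w i = 0 := by
      rw [← (Submodule.Quotient.mk_eq_zero L).2 hc, ← Submodule.mkQ_apply]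
      simp only [map_sum, map_smul L.mkQ, hsmul, ← hem]
    rw [← Ideal.Quotient.eq_zero_iff_mem, map_mul, hef]
    exact hind _ hsum i

theorem le_of_le_sup_jacobson_smul {R N : Type*} [Ring R] [AddCommGroup N] [Module R N]
    {P L : Submodule R N} (hP : P.FG) (h : P ≤ L ⊔ Ring.jacobson R • P) : P ≤ L := by
  have hquot : P.map L.mkQ ≤ Ring.jacobson R • P.map L.mkQ := by
    refine (Submodule.map_mono h).trans ?_
    rw [Submodule.map_sup, Submodule.mkQ_map_self, bot_sup_eq, Submodule.map_smul'']
  have hbot := (hP.map L.mkQ).eq_bot_of_le_jacobson_smul hquot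
  rwa [← LinearMap.le_ker_iff_map, Submodule.ker_mkQ] at hbot

section GradedRing

variable {A : Type u} [Ring A] {𝒜 : ℕ → AddSubgroup A}

theorem eq_zero_of_mem_intGrading {k : ℤ} (hk : k < 0) {a : A} (ha : a ∈ intGrading 𝒜 k) :
    a = 0 := by
  rcases k with k | k
  · exact absurd hk (by simp)
  · exact ha

variable [GradedRing 𝒜]

instance gradedRadical_isTwoSided : (gradedRadical 𝒜).IsTwoSided := by
  unfold gradedRadical; infer_instance

theorem coe_mem_gradedRadical_iff {a : 𝒜 0} :
    (a : A) ∈ gradedRadical 𝒜 ↔ a ∈ Ring.jacobson (𝒜 0) := by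
  rw [gradedRadical, Ideal.mem_comap, GradedRing.projZeroRingHom'_apply_coe]

theorem sub_projZero_mem_gradedRadical (a : A) :
    a - GradedRing.projZeroRingHom' 𝒜 a ∈ gradedRadical 𝒜 := by
  rw [gradedRadical, Ideal.mem_comap, map_sub, GradedRing.projZeroRingHom'_apply_coe, sub_self]
  exact zero_mem _

theorem mem_gradedRadical_of_mem_intGrading {k : ℤ} (hk : k ≠ 0) {a : A}
    (ha : a ∈ intGrading 𝒜 k) : a ∈ gradedRadical 𝒜 := by
  rcases k with k | k
  · have : GradedRing.projZeroRingHom' 𝒜 a = 0 :=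
      Subtype.ext (DirectSum.decompose_of_mem_ne 𝒜 ha fun h => hk (by rw [h]; rfl))
    rw [gradedRadical, Ideal.mem_comap, this]
    exact zero_mem _
  · rw [AddSubgroup.mem_bot.1 ha]; exact zero_mem _

theorem isSemisimpleRing_quotient_gradedRadical (h : IsSemiperfectRing (𝒜 0)) :
    IsSemisimpleRing (A ⧸ gradedRadical 𝒜) := by
  have := h.1
  let incl : 𝒜 0 →+* A := (SetLike.GradeZero.subring 𝒜).subtype
  refine RingHom.isSemisimpleRing_of_surjective
    (Ideal.quotientMap (gradedRadical 𝒜) incl fun _ => coe_mem_gradedRadical_iff.2) ?_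
  refine Ideal.Quotient.mk_surjective.forall.2 fun a =>
    ⟨Ideal.Quotient.mk _ (GradedRing.projZeroRingHom' 𝒜 a), ?_⟩
  exact (Ideal.Quotient.eq.2 (sub_projZero_mem_gradedRadical a)).symm

variable (𝒜) in
/-- The component of degree `k` of an element of `A`, where `k` is an arbitrary integer, so that
it can act on a `ℤ`-graded module without a case distinction on the sign of `k`. -/
noncomputable def intComponent (k : ℤ) : A →+ A :=
  internalProj (GrMod.intGrading_isInternal 𝒜) k

theorem intComponent_mem (k : ℤ) (a : A) : intComponent 𝒜 k a ∈ intGrading 𝒜 k :=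
  internalProj_mem _ _ _

end GradedRing

namespace GrMod

variable {A : Type u} [Ring A] {𝒜 : ℕ → AddSubgroup A} {M : GrMod 𝒜}

theorem proj_mem (M : GrMod 𝒜) (k : ℤ) (m : M) : M.proj k m ∈ M.grading k :=
  internalProj_mem _ _ _

theorem proj_same {k : ℤ} {m : M} (hm : m ∈ M.grading k) : M.proj k m = m :=
  internalProj_same _ _ _ hm

theorem proj_ne {k l : ℤ} (h : k ≠ l) {m : M} (hm : m ∈ M.grading l) : M.proj k m = 0 :=
  internalProj_ne _ _ _ h _ hm

theorem mem_of_proj_mem (N : AddSubgroup M) {m : M} (h : ∀ k, M.proj k m ∈ N) : m ∈ N := by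
  obtain ⟨s, hs⟩ := exists_sum_internalProj M.isInternal m
  exact hs ▸ sum_mem fun k _ => h k

theorem smul_mem_of_mem_intGrading {i k : ℤ} {a : A} {m : M} (ha : a ∈ intGrading 𝒜 i)
    (hm : m ∈ M.grading k) : a • m ∈ M.grading (i + k) := by
  rcases i with i | i
  · exact M.smul_mem i k a m ha hm
  · rw [AddSubgroup.mem_bot.1 ha, zero_smul]; exact zero_mem _

theorem proj_smul_of_mem_intGrading {i : ℤ} {a : A} (ha : a ∈ intGrading 𝒜 i) (k : ℤ) (m : M) :
    M.proj k (a • m) = a • M.proj (k - i) m := by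
  refine internal_induction M.isInternal
    (p := fun m => M.proj k (a • m) = a • M.proj (k - i) m) ?_ (by simp) ?_ m
  · intro l m hm
    by_cases h : k = i + l
    · subst h
      rw [proj_same (smul_mem_of_mem_intGrading ha hm), add_sub_cancel_left, proj_same hm]
    · rw [proj_ne h (smul_mem_of_mem_intGrading ha hm), proj_ne (by lia) hm, smul_zero]
  · intro x y hx hy
    simp only [smul_add, map_add, hx, hy]

section

variable [GradedRing 𝒜]

theorem proj_smul_of_mem {j : ℤ} {m : M} (hm : m ∈ M.grading j) (k : ℤ) (a : A) :
    M.proj k (a • m) = intComponent 𝒜 (k - j) a • m := by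
  refine internal_induction (intGrading_isInternal 𝒜)
    (p := fun a => M.proj k (a • m) = intComponent 𝒜 (k - j) a • m) ?_ (by simp) ?_ a
  · intro i a ha
    rw [proj_smul_of_mem_intGrading ha, intComponent]
    by_cases h : k = i + j
    · subst h
      rw [add_sub_cancel_left, add_sub_cancel_right, proj_same hm, internalProj_same _ _ _ ha]
    · rw [proj_ne (by lia) hm, smul_zero, internalProj_ne _ _ _ (by lia) _ ha, zero_smul]
  · intro x y hx hy
    simp only [add_smul, map_add, hx, hy]

/-- The component `Mₖ` as a module over the ring `A₀`, for the theory of modules over a fixed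
ring. -/
def component (M : GrMod 𝒜) (k : ℤ) : Submodule (SetLike.GradeZero.subring 𝒜) M where
  carrier := M.grading k
  add_mem' := add_mem
  zero_mem' := zero_mem _
  smul_mem' a m hm := by simpa only [Nat.cast_zero, zero_add] using! M.smul_mem 0 k a m a.2 hm

theorem component_fg_iff (k : ℤ) :
    (M.component k).FG ↔ IsFGOverDegreeZero 𝒜 (M.grading k) :=
  exists_congr fun _ => Submodule.toAddSubgroup_injective.eq_iff.symm

theorem proj_radical_smul_mem (k : ℤ) {L : Submodule A M}
    (hL : ∀ j < k, ∀ m ∈ M.grading j, m ∈ L) {y : M}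
    (hy : y ∈ gradedRadical 𝒜 • (⊤ : Submodule A M)) :
    M.proj k y ∈ L.restrictScalars (SetLike.GradeZero.subring 𝒜) ⊔
      Ring.jacobson (SetLike.GradeZero.subring 𝒜) • M.component k := by
  refine Submodule.smul_induction_on (p := fun y => M.proj k y ∈ _) hy (fun a ha m _ => ?_)
    fun x y hx hy => by rw [map_add]; exact add_mem hx hy
  refine internal_induction M.isInternal (p := fun m => M.proj k (a • m) ∈ _) (fun j m hm => ?_)
    (by simp) (fun x y hx hy => by rw [smul_add, map_add]; exact add_mem hx hy) m
  rw [proj_smul_of_mem hm]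
  rcases lt_trichotomy k j with hkj | rfl | hkj
  · rw [eq_zero_of_mem_intGrading (sub_neg.2 hkj) (intComponent_mem _ a), zero_smul]
    exact zero_mem _
  · have hzero : intComponent 𝒜 (k - k) a ∈ 𝒜 0 := by
      simpa only [sub_self] using! intComponent_mem (𝒜 := 𝒜) (k - k) a
    exact Submodule.mem_sup_right <| Submodule.smul_mem_smul
      (r := (⟨_, hzero⟩ : SetLike.GradeZero.subring 𝒜))
      (coe_mem_gradedRadical_iff (a := ⟨_, hzero⟩).1 (gradedRadical_homogeneous 𝒜 _ a ha)) hm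
  · exact Submodule.mem_sup_left (L.smul_mem _ (hL j hkj m hm))

/-- Nakayama's lemma: the components of `M` lie in `L` by induction on the degree, the ordinary
lemma over `A₀` being applied to one component at a time. -/
theorem eq_top_of_sup_radical_smul_eq_top (hM : M.IsLeftFinite) (hb : M.IsBoundedBelow)
    {L : Submodule A M} (hL : ∀ k, ∀ m ∈ L, M.proj k m ∈ L)
    (h : L ⊔ gradedRadical 𝒜 • ⊤ = ⊤) : L = ⊤ := by
  obtain ⟨b, hb⟩ := hb
  have hcomp_of_lt (k : ℤ) (ih : ∀ j < k, ∀ m ∈ M.grading j, m ∈ L) : ∀ m ∈ M.grading k, m ∈ L := by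
    have hle : M.component k ≤ L.restrictScalars (SetLike.GradeZero.subring 𝒜) ⊔
        Ring.jacobson (SetLike.GradeZero.subring 𝒜) • M.component k := by
      intro m hm
      obtain ⟨l, hl, y, hy, rfl⟩ := Submodule.mem_sup.1 (h ▸ Submodule.mem_top : m ∈ L ⊔ _)
      rw [← proj_same hm, map_add]
      exact add_mem (Submodule.mem_sup_left (hL k l hl)) (proj_radical_smul_mem k ih hy)
    exact fun m hm => le_of_le_sup_jacobson_smul ((component_fg_iff k).2 (hM k)) hle hm
  have hcomp (k : ℤ) : ∀ m ∈ M.grading k, m ∈ L := by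
    induction k using Int.strongRec (m := b) with
    | lt k hk =>
      intro m hm
      rw [hb k hk] at hm
      exact AddSubgroup.mem_bot.1 hm ▸ zero_mem _
    | ge k _ ih => exact hcomp_of_lt k ih
  exact eq_top_iff.2 fun m _ => mem_of_proj_mem L.toAddSubgroup fun k => hcomp k _ (M.proj_mem k m)

end

/-! ### Free graded modules -/

section Free

variable {I : Type} (d : I → ℤ)

variable (𝒜) in
/-- The component of degree `k` of `⨁ᵢ A(-dᵢ)`. -/
def freeGrading (k : ℤ) : AddSubgroup (I →₀ A) where
  carrier := {f | ∀ i, f i ∈ intGrading 𝒜 (k - d i)}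
  add_mem' hf hg i := add_mem (hf i) (hg i)
  zero_mem' _ := zero_mem _
  neg_mem' hf i := neg_mem (hf i)

variable {d} in
theorem single_mem_freeGrading {k : ℤ} {i : I} {a : A} (ha : a ∈ intGrading 𝒜 (k - d i)) :
    Finsupp.single i a ∈ freeGrading 𝒜 d k := by
  classical
  intro j
  rw [Finsupp.single_apply]
  split_ifs with h
  · exact h ▸ ha
  · exact zero_mem _

variable [GradedRing 𝒜]

variable (𝒜) in
/-- The projection of `⨁ᵢ A(-dᵢ)` to its component of degree `k`. -/
noncomputable def freeProj (k : ℤ) : (I →₀ A) →+ (I →₀ A) :=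
  Finsupp.liftAddHom fun i => (Finsupp.singleAddHom i).comp (intComponent 𝒜 (k - d i))

theorem freeProj_apply (k : ℤ) (f : I →₀ A) (i : I) :
    freeProj 𝒜 d k f i = intComponent 𝒜 (k - d i) (f i) := by
  classical
  induction f using Finsupp.induction_linear with
  | zero => simp
  | add f g hf hg => simp only [map_add, Finsupp.add_apply, hf, hg]
  | single j a => by_cases h : j = i <;> [subst h; skip] <;> simp [freeProj, *]

variable {d}

theorem freeProj_same {k : ℤ} {f : I →₀ A} (hf : f ∈ freeGrading 𝒜 d k) :
    freeProj 𝒜 d k f = f :=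
  Finsupp.ext fun i => (freeProj_apply d k f i).trans (internalProj_same _ _ _ (hf i))

theorem freeProj_ne {k l : ℤ} (hkl : k ≠ l) {f : I →₀ A} (hf : f ∈ freeGrading 𝒜 d l) :
    freeProj 𝒜 d k f = 0 :=
  Finsupp.ext fun i => (freeProj_apply d k f i).trans (internalProj_ne _ _ _ (by lia) _ (hf i))

theorem mem_iSup_freeGrading (f : I →₀ A) : f ∈ ⨆ k, freeGrading 𝒜 d k := by
  induction f using Finsupp.induction_linear with
  | zero => exact zero_mem _
  | add f g hf hg => exact add_mem hf hg
  | single i a =>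
    refine internal_induction (intGrading_isInternal 𝒜) (p := fun a => Finsupp.single i a ∈ _)
      (fun l a ha => ?_) ?_ (fun x y hx hy => ?_) a
    · refine AddSubgroup.mem_iSup_of_mem (l + d i) (single_mem_freeGrading ?_)
      rwa [add_sub_cancel_right]
    · rw [Finsupp.single_zero]; exact zero_mem _
    · rw [Finsupp.single_add]; exact add_mem hx hy

variable (𝒜 d) in
/-- The free graded module `⨁ᵢ A(-dᵢ)`, with a basis of elements of degrees `dᵢ`. -/
noncomputable def free : GrMod 𝒜 where
  carrier := I →₀ A
  grading := freeGrading 𝒜 d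
  isInternal := isInternal_of_proj (freeProj 𝒜 d) (fun _ _ => freeProj_same)
    (fun _ _ hkl _ => freeProj_ne hkl) mem_iSup_freeGrading
  smul_mem i k a f ha hf j := by
    simpa only [add_sub_assoc] using! (regular 𝒜).smul_mem i _ a _ ha (hf j)

theorem free_proj (k : ℤ) (f : I →₀ A) : (free 𝒜 d).proj k f = freeProj 𝒜 d k f := by
  refine internal_induction (free 𝒜 d).isInternal
    (p := fun f => (free 𝒜 d).proj k f = freeProj 𝒜 d k f) (fun l f hf => ?_) ?_ ?_ f
  · by_cases hkl : k = l
    · subst hkl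
      exact (proj_same hf).trans (freeProj_same hf).symm
    · exact (proj_ne hkl hf).trans (freeProj_ne hkl hf).symm
  · exact (map_zero _).trans (map_zero (freeProj 𝒜 d k)).symm
  · intro x y hx hy
    rw [map_add, hx, hy]
    exact (map_add (freeProj 𝒜 d k) x y).symm

theorem regular_isLeftFinite (hfin : IsLeftFiniteRing 𝒜) : (regular 𝒜).IsLeftFinite := by
  rintro (k | k)
  · exact hfin k
  · exact ⟨∅, by simp; rfl⟩

theorem free_isLeftFinite (hfin : IsLeftFiniteRing 𝒜) (hd : ∀ k, {i | d i ≤ k}.Finite) :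
    (free 𝒜 d).IsLeftFinite := by
  intro k
  rw [← component_fg_iff]
  let ℓ (i : I) : regular 𝒜 →ₗ[SetLike.GradeZero.subring 𝒜] free 𝒜 d :=
    LinearMap.restrictScalars _ (show regular 𝒜 →ₗ[A] free 𝒜 d from
      (Finsupp.lsingle i : A →ₗ[A] I →₀ A))
  have hcomp : (free 𝒜 d).component k = ⨆ i ∈ (hd k).toFinset,
      ((regular 𝒜).component (k - d i)).map (ℓ i) := by
    refine le_antisymm (fun (f : I →₀ A) hf => ?_) (iSup₂_le fun i _ => ?_)
    · have hsupp (i : I) (hi : i ∈ f.support) : i ∈ (hd k).toFinset := by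
        by_contra hlt
        have hlt' : k < d i := by simpa using hlt
        exact Finsupp.mem_support_iff.1 hi (eq_zero_of_mem_intGrading (by lia) (hf i))
      rw [← Finsupp.sum_single f]
      exact sum_mem fun i hi => Submodule.mem_iSup_of_mem i
        (Submodule.mem_iSup_of_mem (hsupp i hi) ⟨f i, hf i, rfl⟩)
    · rintro _ ⟨(a : A), ha, rfl⟩
      exact single_mem_freeGrading ha
  rw [hcomp]
  exact Submodule.fg_biSup _ _ fun i _ =>
    ((component_fg_iff _).2 (regular_isLeftFinite hfin _)).map _

theorem free_isBoundedBelow (hd : ∃ b, ∀ i, b ≤ d i) : (free 𝒜 d).IsBoundedBelow := by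
  obtain ⟨b, hb⟩ := hd
  refine ⟨b, fun k hk => (AddSubgroup.eq_bot_iff_forall _).2 fun f hf => Finsupp.ext fun i => ?_⟩
  exact eq_zero_of_mem_intGrading (by linarith [hb i]) (hf i)

variable {M : GrMod 𝒜} {v : I → M}

/-- The morphism `⨁ᵢ A(-dᵢ) → M` that maps the basis to elements of `M` of degrees `dᵢ`. -/
noncomputable def freeHom (hv : ∀ i, v i ∈ M.grading (d i)) : free 𝒜 d ⟶ M :=
  ofLin (M := free 𝒜 d) (Finsupp.linearCombination A v) fun k f hf => by
    refine sum_mem fun i _ => ?_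
    simpa only [sub_add_cancel] using! smul_mem_of_mem_intGrading (hf i) (hv i)

end Free

section Sub

variable {M : GrMod 𝒜} {N : Submodule A M} (hN : ∀ k, ∀ m ∈ N, M.proj k m ∈ N)
include hN

theorem IsBoundedBelow.sub (hM : M.IsBoundedBelow) : (M.sub N hN).IsBoundedBelow := by
  obtain ⟨b, hb⟩ := hM
  refine ⟨b, fun k hk => (AddSubgroup.eq_bot_iff_forall _).2 fun x hx => Subtype.ext ?_⟩
  have hx' : N.subtype x ∈ M.grading k := hx
  rw [hb k hk] at hx'
  exact AddSubgroup.mem_bot.1 hx'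

theorem IsLeftFinite.sub [GradedRing 𝒜] (hnoeth : IsNoetherianRing (𝒜 0)) (hM : M.IsLeftFinite) :
    (M.sub N hN).IsLeftFinite := by
  intro k
  rw [← component_fg_iff]
  let R := SetLike.GradeZero.subring 𝒜
  have hR : IsNoetherianRing R := hnoeth
  let incl : M.sub N hN →ₗ[R] M := N.subtype.restrictScalars R
  refine Submodule.fg_of_fg_map_injective incl Subtype.val_injective
    (Submodule.FG.of_le ((component_fg_iff k).2 (hM k)) ?_)
  rintro _ ⟨x, hx, rfl⟩
  exact hx

end Sub

/-! ### Homogeneous dual bases -/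

section DualBasis

/-- A homogeneous dual basis `(v, coord)` of the graded module `P`, with finitely many elements of
degrees `≤ k` for every `k`. It makes `P` a direct summand of a free graded module. -/
structure DualBasis (P : GrMod 𝒜) where
  I : Type
  d : I → ℤ
  finite : ∀ k, {i | d i ≤ k}.Finite
  v : I → P
  v_mem : ∀ i, v i ∈ P.grading (d i)
  coord : P →ₗ[A] (I →₀ A)
  coord_mem : ∀ k, ∀ x ∈ P.grading k, ∀ i, coord x i ∈ intGrading 𝒜 (k - d i)
  sum_coord : ∀ x, Finsupp.linearCombination A v (coord x) = x

namespace DualBasis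

variable {P : GrMod 𝒜} (B : DualBasis P)
include B

theorem projective : Projective P := by
  refine ⟨fun {E X} f e he => ?_⟩
  choose m hm hfm using fun i =>
    exists_mem_of_surjective e (surjective_of_epi e) (B.d i) _ (lin_mem f _ _ (B.v_mem i))
  refine ⟨ofLin (Finsupp.linearCombination A m ∘ₗ B.coord) fun k x hx => ?_, hom_ext fun x => ?_⟩
  · refine sum_mem fun i _ => ?_
    simpa only [sub_add_cancel] using! smul_mem_of_mem_intGrading (B.coord_mem k x hx i) (hm i)
  · change lin e (Finsupp.linearCombination A m (B.coord x)) = lin f x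
    conv_rhs => rw [← B.sum_coord x]
    simp only [Finsupp.linearCombination_apply, map_finsuppSum, map_smul, hfm]

theorem sum_coord_smul {k : ℤ} {x : P} (hx : x ∈ P.grading k) :
    ∑ i ∈ (B.finite k).toFinset, B.coord x i • B.v i = x := by
  conv_rhs => rw [← B.sum_coord x, Finsupp.linearCombination_apply]
  refine (Finsupp.sum_of_support_subset _ (fun i hi => ?_) (fun i a => a • B.v i)
    fun _ _ => zero_smul _ _).symm
  rw [Set.Finite.mem_toFinset]
  by_contra hlt
  exact Finsupp.mem_support_iff.1 hi <|
    eq_zero_of_mem_intGrading (sub_neg.2 (not_le.1 hlt)) (B.coord_mem _ _ hx i)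

end DualBasis

end DualBasis

variable [GradedRing 𝒜]

section Idempotent

variable {I : Type} {e : I → A}

variable (e) in
/-- The submodule `⨁ᵢ A eᵢ` of `⨁ᵢ A`. -/
def idempotentSubmodule : Submodule A (I →₀ A) where
  carrier := {f | ∀ i, f i * e i = f i}
  add_mem' hf hg i := by rw [Finsupp.add_apply, add_mul, hf i, hg i]
  zero_mem' i := by simp
  smul_mem' a f hf i := by rw [Finsupp.smul_apply, smul_eq_mul, mul_assoc, hf i]

theorem idempotentSubmodule_homogeneous {d : I → ℤ} (he : ∀ i, e i ∈ 𝒜 0) (k : ℤ) (f : I →₀ A)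
    (hf : f ∈ idempotentSubmodule e) : (free 𝒜 d).proj k f ∈ idempotentSubmodule e := by
  rw [free_proj]
  intro i
  have h := proj_smul_of_mem (M := regular 𝒜) (j := 0) (m := e i) (he i) (k - d i) (f i)
  rw [sub_zero] at h
  rw [freeProj_apply]
  exact h.symm.trans (congrArg (intComponent 𝒜 (k - d i)) (hf i))

variable (𝒜) in
/-- The graded module `⨁ᵢ A eᵢ(-dᵢ)` for elements `eᵢ` of degree zero. -/
noncomputable def idempotentSum (d : I → ℤ) (he : ∀ i, e i ∈ 𝒜 0) : GrMod 𝒜 :=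
  (free 𝒜 d).sub (idempotentSubmodule e) (idempotentSubmodule_homogeneous he)

/-- The element `eᵢ` of `⨁ᵢ A eᵢ`. -/
noncomputable def idempotentSingle (hee : ∀ i, IsIdempotentElem (e i)) (i : I) :
    idempotentSubmodule e :=
  ⟨Finsupp.single i (e i), fun j => by
    by_cases h : i = j
    · rw [← h, Finsupp.single_eq_same, (hee i).eq]
    · rw [Finsupp.single_eq_of_ne' h, zero_mul]⟩

theorem linearCombination_idempotentSingle (hee : ∀ i, IsIdempotentElem (e i))
    (x : idempotentSubmodule e) :
    Finsupp.linearCombination A (idempotentSingle hee) (x : I →₀ A) = x := by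
  refine Subtype.ext ?_
  conv_rhs => rw [← Finsupp.sum_single (x : I →₀ A)]
  rw [Finsupp.linearCombination_apply, Finsupp.sum, AddSubmonoidClass.coe_finsetSum]
  refine Finset.sum_congr rfl fun i _ => ?_
  change (x : I →₀ A) i • Finsupp.single i (e i) = Finsupp.single i ((x : I →₀ A) i)
  rw [Finsupp.smul_single, smul_eq_mul, x.2 i]

/-- The dual basis of `⨁ᵢ A eᵢ(-dᵢ)` given by the elements `eᵢ`. -/
noncomputable def idempotentSumDualBasis {d : I → ℤ} (he : ∀ i, e i ∈ 𝒜 0)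
    (hee : ∀ i, IsIdempotentElem (e i)) (hd : ∀ k, {i | d i ≤ k}.Finite) :
    DualBasis (idempotentSum 𝒜 d he) where
  I := I
  d := d
  finite := hd
  v := idempotentSingle hee
  v_mem i := single_mem_freeGrading (by rw [sub_self]; exact he i)
  coord := (idempotentSubmodule e).subtype
  coord_mem _ _ hx i := hx i
  sum_coord x := linearCombination_idempotentSingle hee x

end Idempotent

/-! ### Projective covers -/

theorem exists_component_generators (hsemi : IsSemiperfectRing (𝒜 0)) (hM : M.IsLeftFinite)
    (k : ℤ) :
    ∃ (r : ℕ) (v : Fin r → M) (e : Fin r → 𝒜 0), (∀ i, v i ∈ M.grading k) ∧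
      (∀ i, IsIdempotentElem (e i)) ∧ (∀ i, (e i : A) • v i = v i) ∧
      (∀ x ∈ M.grading k, x ∈ Submodule.span A (Set.range v) ⊔ gradedRadical 𝒜 • ⊤) ∧
      ∀ c : Fin r → 𝒜 0, ∑ i, (c i : A) • v i ∈ gradedRadical 𝒜 • (⊤ : Submodule A M) →
        ∀ i, (c i * e i : A) ∈ gradedRadical 𝒜 := by
  let R := SetLike.GradeZero.subring 𝒜
  have hR : IsSemiperfectRing R := hsemi
  have : Module.Finite R (M.component k) := .of_fg ((component_fg_iff k).2 (hM k))
  let L : Submodule R (M.component k) :=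
    ((gradedRadical 𝒜 • (⊤ : Submodule A M)).restrictScalars R).comap (M.component k).subtype
  have hL : Ring.jacobson R • ⊤ ≤ L := Submodule.smul_le.2 fun a ha x _ =>
    Submodule.smul_mem_smul (coe_mem_gradedRadical_iff.2 ha) (Submodule.mem_top (x := (x : M)))
  obtain ⟨r, m, e, hee, hem, hspan, hind⟩ := hR.exists_idempotent_generators hL
  refine ⟨r, fun i => m i, e, fun i => (m i).2, hee, fun i => congrArg Subtype.val (hem i),
    fun x hx => ?_, fun c hc i => coe_mem_gradedRadical_iff.2 (hind c ?_ i)⟩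
  · obtain ⟨y, hy, z, hz, hyz⟩ := Submodule.mem_sup.1
      (hspan ▸ Submodule.mem_top : (⟨x, hx⟩ : M.component k) ∈ L ⊔ _)
    obtain ⟨c, rfl⟩ := (Submodule.mem_span_range_iff_exists_fun R).1 hz
    have hx : x = ∑ i, (c i : A) • (m i : M) + y := by
      rw [add_comm]
      simpa using! congrArg Subtype.val hyz.symm
    rw [hx]
    exact add_mem (Submodule.mem_sup_left <| sum_mem fun i _ => Submodule.smul_mem _ _
      (Submodule.subset_span ⟨i, rfl⟩)) (Submodule.mem_sup_right hy)
  · change (M.component k).subtype (∑ i, (show R from c i) • m i) ∈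
      gradedRadical 𝒜 • (⊤ : Submodule A M)
    rw [map_sum]
    exact hc

/-- Homogeneous elements `vᵢ` of `M`, finitely many in degrees `≤ k` for every `k`, and idempotents
`eᵢ` of degree zero with `eᵢ vᵢ = vᵢ` such that `M / J M` is the direct sum of its submodules
`A vᵢ ≅ (A / J) eᵢ`. -/
structure TopGenerators (M : GrMod 𝒜) where
  I : Type
  d : I → ℤ
  finite : ∀ k, {i | d i ≤ k}.Finite
  bounded : ∃ b, ∀ i, b ≤ d i
  v : I → M
  v_mem : ∀ i, v i ∈ M.grading (d i)
  e : I → A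
  e_mem : ∀ i, e i ∈ 𝒜 0
  e_idem : ∀ i, IsIdempotentElem (e i)
  e_smul : ∀ i, e i • v i = v i
  span_sup : Submodule.span A (Set.range v) ⊔ gradedRadical 𝒜 • ⊤ = ⊤
  independent : ∀ c : I →₀ A,
    Finsupp.linearCombination A v c ∈ gradedRadical 𝒜 • (⊤ : Submodule A M) →
      ∀ i, c i * e i ∈ gradedRadical 𝒜

theorem projZero_smul_sub_mem (a : A) (m : M) :
    (GradedRing.projZeroRingHom' 𝒜 a : A) • m - a • m ∈
      gradedRadical 𝒜 • (⊤ : Submodule A M) := by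
  rw [← neg_mem_iff, neg_sub, ← sub_smul]
  exact Submodule.smul_mem_smul (sub_projZero_mem_gradedRadical a) Submodule.mem_top

theorem radical_smul_top_homogeneous (k : ℤ) (x : M)
    (hx : x ∈ gradedRadical 𝒜 • (⊤ : Submodule A M)) :
    M.proj k x ∈ gradedRadical 𝒜 • (⊤ : Submodule A M) := by
  refine Submodule.smul_induction_on (p := fun x => M.proj k x ∈ _) hx (fun a ha m _ => ?_)
    fun x y hx hy => by rw [map_add]; exact add_mem hx hy
  refine internal_induction M.isInternal (p := fun m => M.proj k (a • m) ∈ _) (fun j m hm => ?_)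
    (by simp) (fun x y hx hy => by rw [smul_add, map_add]; exact add_mem hx hy) m
  rw [proj_smul_of_mem hm]
  exact Submodule.smul_mem_smul (gradedRadical_homogeneous 𝒜 _ a ha) Submodule.mem_top

section DegreewiseFamily

variable {b : ℤ} {r : ℕ → ℕ} {v : (n : ℕ) → Fin (r n) → M}

theorem finite_setOf_add_fst_le (b k : ℤ) (r : ℕ → ℕ) :
    {i : Σ n : ℕ, Fin (r n) | b + i.1 ≤ k}.Finite :=
  ((Finset.range (k - b + 1).toNat).sigma fun _ => Finset.univ).finite_toSet.subset
    fun i (hi : b + i.1 ≤ k) => by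
      simp only [Finset.coe_sigma, Set.mem_sigma_iff, Finset.coe_range, Set.mem_Iio,
        Finset.coe_univ, Set.mem_univ, and_true]
      lia

theorem proj_sum_projZero_smul (hv : ∀ (n : ℕ) i, v n i ∈ M.grading (b + n)) (n : ℕ)
    (c : (Σ n, Fin (r n)) →₀ A) :
    M.proj (b + n) (c.sum fun i a => (GradedRing.projZeroRingHom' 𝒜 a : A) • v i.1 i.2) =
      ∑ i, (GradedRing.projZeroRingHom' 𝒜 (c ⟨n, i⟩) : A) • v n i := by
  classical
  induction c using Finsupp.induction_linear with
  | zero => simp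
  | add f g hf hg =>
    rw [Finsupp.sum_add_index' (by simp) (by simp [add_smul]), map_add, hf, hg,
      ← Finset.sum_add_distrib]
    simp only [Finsupp.add_apply, map_add, AddSubgroup.coe_add, add_smul]
  | single i a =>
    obtain ⟨l, i⟩ := i
    have hmem : (GradedRing.projZeroRingHom' 𝒜 a : A) • v l i ∈ M.grading (b + l) :=
      (M.component _).smul_mem (GradedRing.projZeroRingHom' 𝒜 a) (hv l i)
    rw [Finsupp.sum_single_index (by simp)]
    by_cases hl : l = n
    · subst hl
      rw [proj_same hmem, Finset.sum_eq_single i (fun j _ hj => ?_) (by simp),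
        Finsupp.single_eq_same]
      rw [Finsupp.single_eq_of_ne (by simpa using hj), map_zero, ZeroMemClass.coe_zero, zero_smul]
    · rw [proj_ne (by lia) hmem, Finset.sum_eq_zero fun j _ => ?_]
      rw [Finsupp.single_eq_of_ne (by rintro ⟨⟩; exact hl rfl), map_zero, ZeroMemClass.coe_zero,
        zero_smul]

theorem radical_independent_of_component {e : (n : ℕ) → Fin (r n) → 𝒜 0}
    (hv : ∀ (n : ℕ) i, v n i ∈ M.grading (b + n))
    (hind : ∀ n (c : Fin (r n) → 𝒜 0),
      ∑ i, (c i : A) • v n i ∈ gradedRadical 𝒜 • (⊤ : Submodule A M) →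
        ∀ i, (c i * e n i : A) ∈ gradedRadical 𝒜)
    (c : (Σ n, Fin (r n)) →₀ A)
    (hc : Finsupp.linearCombination A (fun i => v i.1 i.2) c ∈
      gradedRadical 𝒜 • (⊤ : Submodule A M)) (i : Σ n, Fin (r n)) :
    c i * e i.1 i.2 ∈ gradedRadical 𝒜 := by
  have hzero : (c.sum fun i a => (GradedRing.projZeroRingHom' 𝒜 a : A) • v i.1 i.2) ∈
      gradedRadical 𝒜 • (⊤ : Submodule A M) := by
    refine (Submodule.sub_mem_iff_left _ hc).1 ?_
    rw [Finsupp.linearCombination_apply, Finsupp.sum, Finsupp.sum, ← Finset.sum_sub_distrib]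
    exact sum_mem fun i _ => projZero_smul_sub_mem _ _
  obtain ⟨n, i⟩ := i
  have hcomp := radical_smul_top_homogeneous (b + n) _ hzero
  rw [proj_sum_projZero_smul hv] at hcomp
  have hsub := (gradedRadical 𝒜).mul_mem_right (e n i : A)
    (sub_projZero_mem_gradedRadical (𝒜 := 𝒜) (c ⟨n, i⟩))
  rw [sub_mul] at hsub
  exact (Submodule.sub_mem_iff_left _ (hind n _ hcomp i)).1 hsub

end DegreewiseFamily

theorem exists_topGenerators (hsemi : IsSemiperfectRing (𝒜 0)) (hM : M.IsLeftFinite)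
    (hb : M.IsBoundedBelow) : Nonempty (TopGenerators M) := by
  obtain ⟨b, hb⟩ := hb
  choose r v e hv hee hev hspan hind using
    fun n : ℕ => exists_component_generators hsemi hM (b + n)
  refine ⟨{
    I := Σ n, Fin (r n)
    d := fun i => b + i.1
    finite := fun k => finite_setOf_add_fst_le b k r
    bounded := ⟨b, fun i => by lia⟩
    v := fun i => v i.1 i.2
    v_mem := fun i => hv _ _
    e := fun i => e i.1 i.2
    e_mem := fun i => (e i.1 i.2).2
    e_idem := fun i => congrArg Subtype.val (hee i.1 i.2)
    e_smul := fun i => hev _ _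
    span_sup := eq_top_iff.2 fun x _ => mem_of_proj_mem
      (Submodule.span A _ ⊔ gradedRadical 𝒜 • ⊤).toAddSubgroup fun k => ?_
    independent := radical_independent_of_component hv hind }⟩
  have hx := M.proj_mem k x
  by_cases hk : k < b
  · rw [hb k hk, AddSubgroup.mem_bot] at hx
    exact hx ▸ zero_mem _
  · obtain ⟨n, rfl⟩ : ∃ n : ℕ, k = b + n := ⟨(k - b).toNat, by lia⟩
    have hrange : Set.range (v n) ⊆ Set.range fun i : Σ n, Fin (r n) => v i.1 i.2 :=
      Set.range_subset_iff.2 fun i => ⟨⟨n, i⟩, rfl⟩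
    have hspan' := Submodule.span_mono (R := A) hrange
    exact sup_le_sup_right hspan' (gradedRadical 𝒜 • ⊤) (hspan n _ hx)

namespace TopGenerators

variable (G : TopGenerators M)

/-- The graded module `⨁ᵢ A eᵢ(-dᵢ)`, a projective cover of `M`. -/
noncomputable def cover : GrMod 𝒜 := idempotentSum 𝒜 G.d G.e_mem

/-- The morphism `⨁ᵢ A eᵢ(-dᵢ) → M` that maps `eᵢ` to `vᵢ`. -/
noncomputable def coverπ : G.cover ⟶ M :=
  (free 𝒜 G.d).subι _ (idempotentSubmodule_homogeneous G.e_mem) ≫ freeHom G.v_mem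

theorem v_mem_range (i : G.I) : G.v i ∈ LinearMap.range (lin G.coverπ) := by
  refine ⟨idempotentSingle G.e_idem i, ?_⟩
  change Finsupp.linearCombination A G.v (Finsupp.single i (G.e i)) = G.v i
  rw [Finsupp.linearCombination_single, G.e_smul]

theorem coverπ_surjective (hM : M.IsLeftFinite) (hb : M.IsBoundedBelow) :
    Function.Surjective (lin G.coverπ) := by
  refine LinearMap.range_eq_top.1 (eq_top_of_sup_radical_smul_eq_top hM hb
    (range_homogeneous G.coverπ) (eq_top_iff.2 (G.span_sup.ge.trans (sup_le_sup_right ?_ _))))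
  exact Submodule.span_le.2 (Set.range_subset_iff.2 G.v_mem_range)

theorem ker_coverπ_le :
    LinearMap.ker (lin G.coverπ) ≤ gradedRadical 𝒜 • (⊤ : Submodule A G.cover) := by
  intro (x : idempotentSubmodule G.e) (hx : Finsupp.linearCombination A G.v x = 0)
  have hcoord (i : G.I) : (x : G.I →₀ A) i ∈ gradedRadical 𝒜 :=
    x.2 i ▸ G.independent x (hx ▸ zero_mem _) i
  have hsum := linearCombination_idempotentSingle G.e_idem x
  rw [← hsum, Finsupp.linearCombination_apply]
  exact sum_mem fun i _ => Submodule.smul_mem_smul (hcoord i) Submodule.mem_top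

end TopGenerators

theorem exists_projectiveCover (hfin : IsLeftFiniteRing 𝒜) (hnoeth : IsNoetherianRing (𝒜 0))
    (hsemi : IsSemiperfectRing (𝒜 0)) (hM : M.IsLeftFinite) (hb : M.IsBoundedBelow) :
    ∃ (P : GrMod 𝒜) (π : P ⟶ M), Nonempty (DualBasis P) ∧ P.IsLeftFinite ∧ P.IsBoundedBelow ∧
      Function.Surjective (lin π) ∧
      LinearMap.ker (lin π) ≤ gradedRadical 𝒜 • (⊤ : Submodule A P) := by
  obtain ⟨G⟩ := exists_topGenerators hsemi hM hb
  exact ⟨G.cover, G.coverπ, ⟨idempotentSumDualBasis G.e_mem G.e_idem G.finite⟩,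
    (free_isLeftFinite hfin G.finite).sub (idempotentSubmodule_homogeneous G.e_mem) hnoeth,
    (free_isBoundedBelow G.bounded).sub (idempotentSubmodule_homogeneous G.e_mem),
    G.coverπ_surjective hM hb, G.ker_coverπ_le⟩

end GrMod

namespace GrMod

variable {A : Type u} [Ring A] {𝒜 : ℕ → AddSubgroup A}

/-! ### Minimal resolutions and their syzygies -/

section Resolutions

theorem subι_shortExact {P X : GrMod 𝒜} (f : P ⟶ X) (hf : Function.Surjective (lin f))
    {N : Submodule A P} {hN : ∀ k, ∀ m ∈ N, P.proj k m ∈ N} (h : N = LinearMap.ker (lin f))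
    (w : P.subι N hN ≫ f = 0) : (ShortComplex.mk (P.subι N hN) f w).ShortExact := by
  subst h
  have hepi : Epi f := ⟨fun g g' hg => hom_ext fun x => by
    obtain ⟨y, rfl⟩ := hf x
    exact LinearMap.congr_fun (congrArg lin hg) y⟩
  have hmono : Mono (P.subι _ hN) := ⟨fun g g' hg => hom_ext fun x =>
    Subtype.ext (LinearMap.congr_fun (congrArg lin hg) x)⟩
  exact { exact := ShortComplex.exact_of_f_is_kernel _ (kernelIsLimit f) }

namespace GrProjRes

/-- The projective resolution of `N 0` obtained by splicing exact sequences
`0 → N (n + 1) → P n → N n → 0` with `P n` projective. -/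
def splice (N P : ℕ → GrMod 𝒜) (hP : ∀ n, Projective (P n)) (π : ∀ n, P n ⟶ N n)
    (ι : ∀ n, N (n + 1) ⟶ P n) (hπ : ∀ n, Function.Surjective (lin (π n)))
    (hι : ∀ n, Function.Injective (lin (ι n)))
    (h : ∀ n, LinearMap.range (lin (ι n)) = LinearMap.ker (lin (π n))) : GrProjRes (N 0) :=
  have hrange (n : ℕ) : LinearMap.range (lin (π (n + 1) ≫ ι n)) = LinearMap.ker (lin (π n)) :=
    (LinearMap.range_comp_of_range_eq_top _ (LinearMap.range_eq_top.2 (hπ (n + 1)))).trans (h n)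
  have hker (n : ℕ) : LinearMap.ker (lin (π (n + 1) ≫ ι n)) = LinearMap.ker (lin (π (n + 1))) :=
    LinearMap.ker_comp_of_ker_eq_bot _ (LinearMap.ker_eq_bot.2 (hι n))
  { P := P
    projective := hP
    ε := π 0
    d := fun n => π (n + 1) ≫ ι n
    ε_surjective := hπ 0
    exact_zero := hrange 0
    exact_succ := fun n => (hrange (n + 1)).trans (hker n).symm }

variable {M : GrMod 𝒜} (R : GrProjRes M)

theorem kerD_homogeneous (n : ℕ) (k : ℤ) (m : R.P n) (hm : m ∈ R.kerD n) :
    (R.P n).proj k m ∈ R.kerD n := by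
  cases n with
  | zero => exact ker_homogeneous R.ε k m hm
  | succ n => exact ker_homogeneous (R.d n) k m hm

theorem range_d (n : ℕ) : LinearMap.range (lin (R.d n)) = R.kerD n := by
  cases n with
  | zero => exact R.exact_zero
  | succ n => exact R.exact_succ n

/-- The syzygies `Ω⁰ M = M` and `Ωⁿ⁺¹ M = Ker dₙ ⊆ Pₙ` of the resolution. -/
def syzygy : ℕ → GrMod 𝒜
  | 0 => M
  | n + 1 => (R.P n).sub (R.kerD n) (R.kerD_homogeneous n)

/-- The projection `Pₙ → Ωⁿ M` induced by the differential. -/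
def syzygyπ : (n : ℕ) → (R.P n ⟶ R.syzygy n)
  | 0 => R.ε
  | n + 1 => ofLin (N := R.syzygy (n + 1))
      (LinearMap.codRestrict (R.kerD n) (lin (R.d n)) fun x => (R.range_d n).le ⟨x, rfl⟩)
      (fun k m hm => lin_mem (R.d n) k m hm)

theorem syzygyπ_surjective (n : ℕ) : Function.Surjective (lin (R.syzygyπ n)) := by
  cases n with
  | zero => exact R.ε_surjective
  | succ n =>
    rintro ⟨x, hx⟩
    obtain ⟨y, hy⟩ := (R.range_d n).ge hx
    exact ⟨y, Subtype.ext hy⟩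

theorem kerD_eq_ker_syzygyπ (n : ℕ) : R.kerD n = LinearMap.ker (lin (R.syzygyπ n)) := by
  cases n with
  | zero => rfl
  | succ n => exact (LinearMap.ker_codRestrict _ _ _).symm

/-- The inclusion `Ωⁿ⁺¹ M → Pₙ`. -/
def syzygyι (n : ℕ) : R.syzygy (n + 1) ⟶ R.P n :=
  (R.P n).subι (R.kerD n) (R.kerD_homogeneous n)

theorem syzygyι_comp_syzygyπ (n : ℕ) : R.syzygyι n ≫ R.syzygyπ n = 0 :=
  hom_ext fun (m : R.kerD n) => (R.kerD_eq_ker_syzygyπ n).le m.2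

/-- The short complex `Ωⁿ⁺¹ M → Pₙ → Ωⁿ M`. -/
def syzygySequence (n : ℕ) : ShortComplex (GrMod 𝒜) :=
  ShortComplex.mk (R.syzygyι n) (R.syzygyπ n) (R.syzygyι_comp_syzygyπ n)

theorem syzygySequence_shortExact (n : ℕ) : (R.syzygySequence n).ShortExact :=
  subι_shortExact (R.syzygyπ n) (R.syzygyπ_surjective n) (R.kerD_eq_ker_syzygyπ n) _

theorem IsMinimal.kerD_le [GradedRing 𝒜] {R : GrProjRes M} (hR : R.IsMinimal) (n : ℕ) :
    R.kerD n ≤ gradedRadical 𝒜 • ⊤ :=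
  (R.range_d n).ge.trans (hR n)

end GrProjRes

theorem exists_minimal_resolution [GradedRing 𝒜] (hfin : IsLeftFiniteRing 𝒜)
    (hnoeth : IsNoetherianRing (𝒜 0)) (hsemi : IsSemiperfectRing (𝒜 0))
    {M : GrMod 𝒜} (hM : M.IsLeftFinite) (hb : M.IsBoundedBelow) :
    ∃ R : GrProjRes M, R.IsMinimal ∧ ∀ n, Nonempty (DualBasis (R.P n)) := by
  let C := {N : GrMod 𝒜 // N.IsLeftFinite ∧ N.IsBoundedBelow}
  choose P π hB hPf hPb hsurj hker using
    fun N : C => exists_projectiveCover hfin hnoeth hsemi N.2.1 N.2.2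
  let Ω (N : C) : C := ⟨(P N).sub (LinearMap.ker (lin (π N))) (ker_homogeneous (π N)),
    (hPf N).sub _ hnoeth, (hPb N).sub _⟩
  let N (n : ℕ) : C := Nat.rec ⟨M, hM, hb⟩ (fun _ => Ω) n
  let ι (n : ℕ) : (N (n + 1)).1 ⟶ P (N n) := (P (N n)).subι _ (ker_homogeneous (π (N n)))
  have hι (n : ℕ) : LinearMap.range (lin (ι n)) = LinearMap.ker (lin (π (N n))) :=
    Submodule.range_subtype _
  let R : GrProjRes M := GrProjRes.splice (fun n => (N n).1) (fun n => P (N n))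
    (fun n => (hB (N n)).some.projective) (fun n => π (N n)) ι (fun n => hsurj (N n))
    (fun _ => Subtype.val_injective) hι
  have hR : R.IsMinimal := fun n =>
    (LinearMap.range_comp_le_range (lin (π (N (n + 1)))) (lin (ι n))).trans
      ((hι n).trans_le (hker (N n)))
  exact ⟨R, hR, fun n => hB (N n)⟩

end Resolutions

/-! ### Maps to shifts of `S` and of the radical -/

section SimpleTop

variable {N Y : GrMod 𝒜}

/-- The linear map `N → Y` underlying a morphism `N → Y(l)` of graded modules. -/
def unshift {l : ℤ} (u : N ⟶ (shiftFunctor 𝒜 l).obj Y) : N →ₗ[A] Y :=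
  lin (N := Y.shift l) u

theorem unshift_sum_apply {l : ℤ} {ι : Type*} (s : Finset ι)
    (u : ι → (N ⟶ (shiftFunctor 𝒜 l).obj Y)) (x : N) :
    unshift (∑ i ∈ s, u i) x = ∑ i ∈ s, unshift (u i) x :=
  map_sum (AddMonoidHom.mk' (fun u : N ⟶ (shiftFunctor 𝒜 l).obj Y => unshift u x)
    fun _ _ => rfl) u s

variable [GradedRing 𝒜]

theorem radical_smul_simpleTop : ∀ a ∈ gradedRadical 𝒜, ∀ x : simpleTop 𝒜, a • x = 0 :=
  fun a ha x => by
    obtain ⟨b, rfl⟩ := (gradedRadical 𝒜).mkQ_surjective x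
    exact (Submodule.Quotient.mk_eq_zero _).2 ((gradedRadical 𝒜).mul_mem_right b ha)

theorem mem_simpleTop_grading_zero (x : simpleTop 𝒜) : x ∈ (simpleTop 𝒜).grading 0 := by
  obtain ⟨a, rfl⟩ := (gradedRadical 𝒜).mkQ_surjective x
  exact ⟨(GradedRing.projZeroRingHom' 𝒜 a : A), SetLike.coe_mem _,
    ((Submodule.Quotient.eq _).2 (sub_projZero_mem_gradedRadical a)).symm⟩

theorem map_proj_smul_simpleTop (φ : N →ₗ[A] simpleTop 𝒜) (k : ℤ) (a : A) (x : N) :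
    φ (N.proj k (a • x)) = a • φ (N.proj k x) := by
  refine internal_induction (intGrading_isInternal 𝒜)
    (p := fun a => φ (N.proj k (a • x)) = a • φ (N.proj k x)) (fun i a ha => ?_) (by simp)
    (fun a b ha hb => by simp only [add_smul, map_add, ha, hb]) a
  rw [proj_smul_of_mem_intGrading ha, map_smul]
  by_cases hi : i = 0
  · rw [hi, sub_zero]
  · have haJ := mem_gradedRadical_of_mem_intGrading hi ha
    rw [radical_smul_simpleTop a haJ, radical_smul_simpleTop a haJ]

/-- The morphism `N → S(l)` which agrees with the linear map `φ` on the component of degree `-l`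
and vanishes on the others. -/
noncomputable def gradedPart (φ : N →ₗ[A] simpleTop 𝒜) (l : ℤ) :
    N ⟶ (shiftFunctor 𝒜 l).obj (simpleTop 𝒜) :=
  ofLin (N := (simpleTop 𝒜).shift l)
    { toFun := fun x => φ (N.proj (-l) x)
      map_add' := fun x y => by rw [map_add, map_add]; rfl
      map_smul' := map_proj_smul_simpleTop φ (-l) }
    fun k x hx => by
      change φ (N.proj (-l) x) ∈ (simpleTop 𝒜).grading (k + l)
      by_cases h : k + l = 0
      · exact h ▸ mem_simpleTop_grading_zero _
      · rw [proj_ne (by lia) hx, map_zero]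
        exact zero_mem _

theorem unshift_proj_neg {l : ℤ} (u : N ⟶ (shiftFunctor 𝒜 l).obj (simpleTop 𝒜)) (x : N) :
    unshift u (N.proj (-l) x) = unshift u x := by
  refine (lin_proj (N := (simpleTop 𝒜).shift l) u (-l) x).trans
    (proj_same (M := (simpleTop 𝒜).shift l) ?_)
  change _ ∈ (simpleTop 𝒜).grading (-l + l)
  rw [neg_add_cancel]
  exact mem_simpleTop_grading_zero _

theorem exists_unshift_ne_zero [IsSemisimpleRing (A ⧸ gradedRadical 𝒜)] {x : N}
    (hx : x ∉ gradedRadical 𝒜 • (⊤ : Submodule A N)) :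
    ∃ (l : ℤ) (u : N ⟶ (shiftFunctor 𝒜 l).obj (simpleTop 𝒜)), unshift u x ≠ 0 := by
  obtain ⟨k, hk⟩ : ∃ k, N.proj k x ∉ gradedRadical 𝒜 • (⊤ : Submodule A N) := by
    by_contra! h
    exact hx (mem_of_proj_mem (gradedRadical 𝒜 • (⊤ : Submodule A N)).toAddSubgroup h)
  obtain ⟨φ, hφ⟩ := exists_linearMap_quotient_apply_ne_zero (gradedRadical 𝒜) hk
  refine ⟨-k, gradedPart φ (-k), ?_⟩
  change φ (N.proj (- -k) x) ≠ 0
  rwa [neg_neg]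

end SimpleTop

section Radical

variable [GradedRing 𝒜]

variable (𝒜) in
/-- The graded radical `J` as a graded module. -/
noncomputable def radical : GrMod 𝒜 :=
  (regular 𝒜).sub (gradedRadical 𝒜) (gradedRadical_homogeneous 𝒜)

variable (𝒜) in
/-- The projection `A → S`. -/
noncomputable def simpleTopπ : regular 𝒜 ⟶ simpleTop 𝒜 :=
  (regular 𝒜).quotπ (gradedRadical 𝒜) (gradedRadical_homogeneous 𝒜)

variable (𝒜) in
/-- The short complex `J → A → S`. -/
noncomputable def radicalSequence : ShortComplex (GrMod 𝒜) :=
  ShortComplex.mk ((regular 𝒜).subι (gradedRadical 𝒜) (gradedRadical_homogeneous 𝒜))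
    (simpleTopπ 𝒜) (hom_ext fun (x : gradedRadical 𝒜) => (Submodule.Quotient.mk_eq_zero _).2 x.2)

theorem radicalSequence_shortExact : (radicalSequence 𝒜).ShortExact :=
  subι_shortExact (simpleTopπ 𝒜) (gradedRadical 𝒜).mkQ_surjective
    (gradedRadical 𝒜).ker_mkQ.symm _

theorem regular_projective : Projective (regular 𝒜) :=
  DualBasis.projective
    { I := Unit
      d := fun _ => 0
      finite := fun _ => Set.toFinite _
      v := fun _ => (1 : A)
      v_mem := fun _ => SetLike.one_mem_graded 𝒜
      coord := (Finsupp.lsingle () : A →ₗ[A] Unit →₀ A)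
      coord_mem := fun k x hx _ => by
        rw [sub_zero]
        exact (Finsupp.single_eq_same (a := ()) (b := (x : A))).symm ▸ hx
      sum_coord := fun x => (Finsupp.linearCombination_single A x ()).trans (mul_one (M := A) x) }

variable {P : GrMod 𝒜} {a : ℤ}

/-- The restriction `N → J(a)` of a morphism `P → A(a)` to a graded submodule `N ⊆ J P`. -/
noncomputable def restrictRadical (h : P ⟶ (shiftFunctor 𝒜 a).obj (regular 𝒜))
    (N : Submodule A P) (hN : ∀ k, ∀ m ∈ N, P.proj k m ∈ N) (hNJ : N ≤ gradedRadical 𝒜 • ⊤) :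
    P.sub N hN ⟶ (shiftFunctor 𝒜 a).obj (radical 𝒜) :=
  ofLin (M := P.sub N hN) (N := (radical 𝒜).shift a)
    (LinearMap.codRestrict (gradedRadical 𝒜) (unshift h ∘ₗ N.subtype)
      fun x => map_mem_of_mem_smul_top (unshift h) (hNJ x.2))
    fun k x hx => lin_mem (N := (regular 𝒜).shift a) h k x.1 hx

variable {N : Submodule A P} {hN : ∀ k, ∀ m ∈ N, P.proj k m ∈ N}

theorem unshift_restrictRadical_mem (h : P ⟶ (shiftFunctor 𝒜 a).obj (regular 𝒜))
    (hNJ : N ≤ gradedRadical 𝒜 • ⊤) {x : N}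
    (hx : (x : P) ∈ gradedRadical 𝒜 • gradedRadical 𝒜 • (⊤ : Submodule A P)) :
    unshift (restrictRadical h N hN hNJ) x ∈
      gradedRadical 𝒜 • (⊤ : Submodule A (radical 𝒜)) := by
  refine (Submodule.mem_smul_top_iff (gradedRadical 𝒜) (gradedRadical 𝒜) _).2 ?_
  have hmap := Submodule.mem_map_of_mem (f := unshift h) hx
  rw [Submodule.map_smul''] at hmap
  refine Submodule.smul_mono le_rfl ?_ hmap
  rintro _ ⟨y, hy, rfl⟩
  exact map_mem_of_mem_smul_top (unshift h) hy

/-- The coordinate morphism `P → A(-dᵢ)` of a dual basis. -/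
noncomputable def DualBasis.coordHom (B : DualBasis P) (i : B.I) :
    P ⟶ (shiftFunctor 𝒜 (-B.d i)).obj (regular 𝒜) :=
  ofLin (N := (regular 𝒜).shift (-B.d i)) (Finsupp.lapply i ∘ₗ B.coord) fun k x hx =>
    B.coord_mem k x hx i

theorem DualBasis.exists_factorization [IsSemisimpleRing (A ⧸ gradedRadical 𝒜)]
    (B : DualBasis P) (hNJ : N ≤ gradedRadical 𝒜 • ⊤)
    (hJ : N ⊓ gradedRadical 𝒜 • gradedRadical 𝒜 • (⊤ : Submodule A P) ≤ gradedRadical 𝒜 • N)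
    {l : ℤ} (u : P.sub N hN ⟶ (shiftFunctor 𝒜 l).obj (simpleTop 𝒜)) :
    ∃ (s : Finset B.I) (g : ∀ i, (shiftFunctor 𝒜 (-B.d i)).obj (radical 𝒜) ⟶
      (shiftFunctor 𝒜 l).obj (simpleTop 𝒜)),
      u = ∑ i ∈ s, restrictRadical (B.coordHom i) N hN hNJ ≫ g i := by
  let JP : Submodule A P := gradedRadical 𝒜 • ⊤
  obtain ⟨φ, hφ⟩ := exists_extension_of_inf_smul_le (gradedRadical 𝒜) radical_smul_simpleTop
    hNJ hJ (unshift u)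
  let mulV (i : B.I) : gradedRadical 𝒜 →ₗ[A] JP := LinearMap.codRestrict _
    (LinearMap.toSpanSingleton A P (B.v i) ∘ₗ (gradedRadical 𝒜).subtype)
    fun x => Submodule.smul_mem_smul x.2 trivial
  let c (i : B.I) : P.sub N hN ⟶ (shiftFunctor 𝒜 (-B.d i)).obj (radical 𝒜) :=
    restrictRadical (B.coordHom i) N hN hNJ
  let g (i : B.I) := gradedPart (N := (radical 𝒜).shift (-B.d i)) (φ ∘ₗ mulV i) l
  refine ⟨(B.finite (-l)).toFinset, g, hom_ext fun x => ?_⟩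
  let y : N := (P.sub N hN).proj (-l) x
  have hg (i : B.I) : unshift (c i ≫ g i) x = φ (mulV i (unshift (c i) y)) :=
    congrArg (φ ∘ₗ mulV i)
      (lin_proj (N := (radical 𝒜).shift (-B.d i)) (c i) (-l) x).symm
  have hsum : ∑ i ∈ (B.finite (-l)).toFinset, mulV i (unshift (c i) y) =
      Submodule.inclusion hNJ y := Subtype.ext <| by
    rw [AddSubmonoidClass.coe_finsetSum]
    exact B.sum_coord_smul ((P.sub N hN).proj_mem (-l) x)
  change unshift u x = unshift (∑ i ∈ (B.finite (-l)).toFinset, c i ≫ g i) x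
  calc unshift u x = unshift u y := (unshift_proj_neg u x).symm
    _ = φ (Submodule.inclusion hNJ y) := (LinearMap.congr_fun hφ y).symm
    _ = ∑ i ∈ (B.finite (-l)).toFinset, unshift (c i ≫ g i) x := by
      rw [← hsum, map_sum]
      exact Finset.sum_congr rfl fun i _ => (hg i).symm
    _ = _ := (unshift_sum_apply _ _ x).symm

end Radical

/-! ### Yoneda products of homogeneous classes -/

section YonedaProduct

/-- The inclusion of the summand `Extⁿ(X, Z(l))` into the graded group `Extⁿ(X, Z)`. -/
noncomputable abbrev GExt.of (X Z : GrMod 𝒜) (n : ℕ) (l : ℤ) :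
    Abelian.Ext.{u + 1} X ((shiftFunctor 𝒜 l).obj Z) n →+ GExt X Z n :=
  DirectSum.of (fun l => Abelian.Ext.{u + 1} X ((shiftFunctor 𝒜 l).obj Z) n) l

variable {X Y Z : GrMod 𝒜} {i j n : ℕ}

theorem yoneda_of (h : i + j = n) (a b : ℤ)
    (β : Abelian.Ext.{u + 1} Y ((shiftFunctor 𝒜 b).obj Z) j)
    (α : Abelian.Ext.{u + 1} X ((shiftFunctor 𝒜 a).obj Y) i) :
    yoneda h (GExt.of Y Z j b β) (GExt.of X Y i a α) =
      GExt.of X Z n (a + b) (yonedaHom h a b β α) := by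
  rw [yoneda, DirectSum.toAddMonoid_of, AddMonoidHom.flip_apply, DirectSum.toAddMonoid_of]
  rfl

theorem yoneda_mem_yonedaSpan (h : i + j = n) (β : GExt Y Z j) (α : GExt X Y i) :
    yoneda h β α ∈ yonedaSpan X Y Z j i n h :=
  AddSubgroup.subset_closure ⟨β, α, rfl⟩

theorem yonedaSpan_le {h : i + j = n} {H : AddSubgroup (GExt X Z n)}
    (hH : ∀ (β : GExt Y Z j) (α : GExt X Y i), yoneda h β α ∈ H) :
    yonedaSpan X Y Z j i n h ≤ H := by
  refine (AddSubgroup.closure_le H).2 ?_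
  rintro _ ⟨β, α, rfl⟩
  exact hH β α

theorem yonedaSpan_le_of_homogeneous {h : i + j = n} {H : AddSubgroup (GExt X Z n)}
    (hH : ∀ a b (β : Abelian.Ext.{u + 1} Y ((shiftFunctor 𝒜 b).obj Z) j)
      (α : Abelian.Ext.{u + 1} X ((shiftFunctor 𝒜 a).obj Y) i),
      GExt.of X Z n (a + b) (yonedaHom h a b β α) ∈ H) :
    yonedaSpan X Y Z j i n h ≤ H := by
  refine yonedaSpan_le fun β α => ?_
  induction β using DirectSum.induction_on with
  | zero => simp
  | add x y hx hy =>
    rw [map_add, AddMonoidHom.add_apply]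
    exact add_mem hx hy
  | of b β =>
    induction α using DirectSum.induction_on with
    | zero => simp
    | add x y hx hy =>
      rw [map_add]
      exact add_mem hx hy
    | of a α =>
      rw [yoneda_of]
      exact hH a b β α

end YonedaProduct

/-! ### Ext groups and syzygies -/

section ExtSyzygy

namespace GrProjRes

variable {M : GrMod 𝒜} (R : GrProjRes M)

/-- The class in `Ext¹(Ωⁿ M, Ωⁿ⁺¹ M)` of `0 → Ωⁿ⁺¹ M → Pₙ → Ωⁿ M → 0`. -/
noncomputable def stepClass (n : ℕ) : Abelian.Ext.{u + 1} (R.syzygy n) (R.syzygy (n + 1)) 1 :=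
  (R.syzygySequence_shortExact n).extClass

/-- The class in `Extⁿ(M, Ωⁿ M)` of `0 → Ωⁿ M → Pₙ₋₁ → ⋯ → P₀ → M → 0`. -/
noncomputable def syzygyClass : (n : ℕ) → Abelian.Ext.{u + 1} M (R.syzygy n) n
  | 0 => Abelian.Ext.mk₀ (𝟙 M)
  | n + 1 => (syzygyClass n).comp (R.stepClass n) rfl

theorem syzygyClass_succ_comp {Y : GrMod 𝒜} {n j m : ℕ} (h : n + 1 + j = m)
    (y : Abelian.Ext.{u + 1} (R.syzygy (n + 1)) Y j) :
    (R.syzygyClass (n + 1)).comp y h =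
      (R.syzygyClass n).comp ((R.stepClass n).comp y (add_comm 1 j)) (by lia) :=
  Abelian.Ext.comp_assoc _ _ _ _ _ (by lia)

theorem exists_syzygyClass_comp_eq {Y : GrMod 𝒜} (n : ℕ) {j m : ℕ} (h : n + j = m)
    (x : Abelian.Ext.{u + 1} M Y m) :
    ∃ y : Abelian.Ext.{u + 1} (R.syzygy n) Y j, (R.syzygyClass n).comp y h = x := by
  induction n generalizing j with
  | zero =>
    obtain rfl : j = m := by simpa using h
    exact ⟨x, Abelian.Ext.mk₀_id_comp x⟩
  | succ n ih =>
    obtain ⟨y, rfl⟩ := ih (j := j + 1) (by lia)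
    have := R.projective n
    obtain ⟨z, rfl⟩ := Abelian.Ext.contravariant_sequence_exact₃ (R.syzygySequence_shortExact n)
      Y y (Abelian.Ext.eq_zero_of_projective (P := R.P n) _) (add_comm 1 j)
    exact ⟨z, R.syzygyClass_succ_comp h z⟩

theorem eq_zero_of_syzygyClass_comp_eq_zero {Y : GrMod 𝒜} (n : ℕ) {j m : ℕ}
    (h : n + (j + 1) = m) {y : Abelian.Ext.{u + 1} (R.syzygy n) Y (j + 1)}
    (hy : (R.syzygyClass n).comp y h = 0) : y = 0 := by
  induction n generalizing j with
  | zero =>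
    obtain rfl : j + 1 = m := by simpa using h
    exact (Abelian.Ext.mk₀_id_comp y).symm.trans hy
  | succ n ih =>
    rw [syzygyClass_succ_comp] at hy
    obtain ⟨z, rfl⟩ := Abelian.Ext.contravariant_sequence_exact₁ (R.syzygySequence_shortExact n)
      Y y _ (ih (by lia) hy)
    have : Projective (R.syzygySequence n).X₂ := R.projective n
    rw [Abelian.Ext.eq_zero_of_projective z, Abelian.Ext.comp_zero]
    rfl

theorem exists_syzygyClass_comp_mk₀_eq {Y : GrMod 𝒜} {n : ℕ} (x : Abelian.Ext.{u + 1} M Y n) :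
    ∃ f : R.syzygy n ⟶ Y, (R.syzygyClass n).comp (Abelian.Ext.mk₀ f) (add_zero n) = x := by
  obtain ⟨y, rfl⟩ := R.exists_syzygyClass_comp_eq n (add_zero n) x
  obtain ⟨f, rfl⟩ := (Abelian.Ext.mk₀_bijective _ _).2 y
  exact ⟨f, rfl⟩

variable [GradedRing 𝒜] {R}

theorem IsMinimal.syzygyι_comp_eq_zero (hR : R.IsMinimal) (n : ℕ) {l : ℤ}
    (v : R.P n ⟶ (shiftFunctor 𝒜 l).obj (simpleTop 𝒜)) : R.syzygyι n ≫ v = 0 :=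
  hom_ext fun (x : R.kerD n) =>
    map_eq_zero_of_mem_smul_top radical_smul_simpleTop (unshift v) (hR.kerD_le n x.2)

theorem IsMinimal.eq_zero_of_syzygyClass_comp_mk₀_eq_zero (hR : R.IsMinimal) (n : ℕ) {l : ℤ}
    {f : R.syzygy n ⟶ (shiftFunctor 𝒜 l).obj (simpleTop 𝒜)}
    (hf : (R.syzygyClass n).comp (Abelian.Ext.mk₀ f) (add_zero n) = 0) : f = 0 := by
  cases n with
  | zero => exact Abelian.Ext.mk₀_eq_zero_iff f |>.1 ((Abelian.Ext.mk₀_id_comp _).symm.trans hf)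
  | succ n =>
    rw [syzygyClass_succ_comp] at hf
    obtain ⟨z, hz⟩ := Abelian.Ext.contravariant_sequence_exact₁ (R.syzygySequence_shortExact n) _
      (Abelian.Ext.mk₀ f) _ (R.eq_zero_of_syzygyClass_comp_eq_zero n rfl hf)
    obtain ⟨v, rfl⟩ := (Abelian.Ext.mk₀_bijective _ _).2 z
    rw [Abelian.Ext.mk₀_comp_mk₀] at hz
    exact ((Abelian.Ext.mk₀_bijective _ _).1 hz).symm.trans (hR.syzygyι_comp_eq_zero n v)

/-- `Hom(Ωⁿ M, S(l)) ≅ Extⁿ(M, S(l))` for a minimal resolution of `M`. -/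
noncomputable def IsMinimal.extEquiv (hR : R.IsMinimal) (n : ℕ) (l : ℤ) :
    (R.syzygy n ⟶ (shiftFunctor 𝒜 l).obj (simpleTop 𝒜)) ≃+
      Abelian.Ext.{u + 1} M ((shiftFunctor 𝒜 l).obj (simpleTop 𝒜)) n :=
  AddEquiv.ofBijective
    (AddMonoidHom.mk' (fun f => (R.syzygyClass n).comp (Abelian.Ext.mk₀ f) (add_zero n))
      fun f g => by rw [Abelian.Ext.mk₀_add, Abelian.Ext.comp_add])
    ⟨(injective_iff_map_eq_zero _).2 fun _ => hR.eq_zero_of_syzygyClass_comp_mk₀_eq_zero n,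
      R.exists_syzygyClass_comp_mk₀_eq⟩

/-- The homomorphism on the graded group `Extⁿ(M, S) = ⨁ₗ Hom(Ωⁿ M, S(l))` given by the evaluation
of maps at an element of `Ωⁿ M`. -/
noncomputable def IsMinimal.evalExt (hR : R.IsMinimal) (n : ℕ) (x : R.syzygy n) :
    GExt M (simpleTop 𝒜) n →+ simpleTop 𝒜 :=
  DirectSum.toAddMonoid fun l =>
    (AddMonoidHom.mk' (fun f : R.syzygy n ⟶ (shiftFunctor 𝒜 l).obj (simpleTop 𝒜) =>
      unshift f x) fun _ _ => rfl).comp (hR.extEquiv n l).symm.toAddMonoidHom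

theorem IsMinimal.evalExt_of (hR : R.IsMinimal) (n : ℕ) (x : R.syzygy n) {l : ℤ}
    (f : R.syzygy n ⟶ (shiftFunctor 𝒜 l).obj (simpleTop 𝒜)) :
    hR.evalExt n x (GExt.of M (simpleTop 𝒜) n l (hR.extEquiv n l f)) = unshift f x := by
  rw [evalExt, DirectSum.toAddMonoid_of]
  exact congrArg (fun f => unshift f x) ((hR.extEquiv n l).symm_apply_apply f)

end GrProjRes

end ExtSyzygy

/-! ### Products with `Ext¹(S, -)` -/

section RadicalClass

variable [GradedRing 𝒜]

variable (𝒜) in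
/-- The class in `Ext¹(S, J)` of the extension `0 → J → A → S → 0`. -/
noncomputable def radicalClass : Abelian.Ext.{u + 1} (simpleTop 𝒜) (radical 𝒜) 1 :=
  radicalSequence_shortExact.extClass

theorem exists_radicalClass_comp_mk₀_eq {Y : GrMod 𝒜}
    (x : Abelian.Ext.{u + 1} (simpleTop 𝒜) Y 1) :
    ∃ g : radical 𝒜 ⟶ Y, (radicalClass 𝒜).comp (Abelian.Ext.mk₀ g) (add_zero 1) = x := by
  have := regular_projective (𝒜 := 𝒜)
  obtain ⟨z, rfl⟩ := Abelian.Ext.contravariant_sequence_exact₃ radicalSequence_shortExact Y x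
    (Abelian.Ext.eq_zero_of_projective (P := regular 𝒜) _) (add_zero 1)
  obtain ⟨f, rfl⟩ := (Abelian.Ext.mk₀_bijective _ _).2 z
  exact ⟨f, rfl⟩

namespace GrProjRes

variable {M : GrMod 𝒜} {R : GrProjRes M}

theorem exists_lift (R : GrProjRes M) (n : ℕ) {a : ℤ}
    (f : R.syzygy n ⟶ (shiftFunctor 𝒜 a).obj (simpleTop 𝒜)) :
    ∃ h : R.P n ⟶ (shiftFunctor 𝒜 a).obj (regular 𝒜),
      R.syzygyπ n ≫ f = h ≫ (shiftFunctor 𝒜 a).map (simpleTopπ 𝒜) := by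
  have := R.projective n
  have : Epi (simpleTopπ 𝒜) := radicalSequence_shortExact.epi_g
  exact ⟨Projective.factorThru (R.syzygyπ n ≫ f) ((shiftFunctor 𝒜 a).map (simpleTopπ 𝒜)),
    (Projective.factorThru_comp _ _).symm⟩

namespace IsMinimal

theorem exists_descent (hR : R.IsMinimal) (n : ℕ) {a : ℤ}
    (h : R.P n ⟶ (shiftFunctor 𝒜 a).obj (regular 𝒜)) :
    ∃ f : R.syzygy n ⟶ (shiftFunctor 𝒜 a).obj (simpleTop 𝒜),
      R.syzygyπ n ≫ f = h ≫ (shiftFunctor 𝒜 a).map (simpleTopπ 𝒜) := by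
  have := (R.syzygySequence_shortExact n).epi_g
  exact ⟨(R.syzygySequence_shortExact n).exact.desc _ (hR.syzygyι_comp_eq_zero n _),
    (R.syzygySequence_shortExact n).exact.g_desc _ (hR.syzygyι_comp_eq_zero n _)⟩

/-- The morphism `Ωⁿ⁺¹ M → J(a)` induced by a morphism `Pₙ → A(a)`. -/
noncomputable def restrict (hR : R.IsMinimal) (n : ℕ) {a : ℤ}
    (h : R.P n ⟶ (shiftFunctor 𝒜 a).obj (regular 𝒜)) :
    R.syzygy (n + 1) ⟶ (shiftFunctor 𝒜 a).obj (radical 𝒜) :=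
  restrictRadical h (R.kerD n) (R.kerD_homogeneous n) (hR.kerD_le n)

theorem stepClass_comp_mk₀_restrict (hR : R.IsMinimal) (n : ℕ) {a : ℤ}
    {h : R.P n ⟶ (shiftFunctor 𝒜 a).obj (regular 𝒜)}
    {f : R.syzygy n ⟶ (shiftFunctor 𝒜 a).obj (simpleTop 𝒜)}
    (hf : R.syzygyπ n ≫ f = h ≫ (shiftFunctor 𝒜 a).map (simpleTopπ 𝒜)) :
    (R.stepClass n).comp (Abelian.Ext.mk₀ (hR.restrict n h)) (add_zero 1) =
      (Abelian.Ext.mk₀ f).comp ((radicalClass 𝒜).mapExactFunctor (shiftFunctor 𝒜 a))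
        (zero_add 1) := by
  let τ : R.syzygySequence n ⟶ (radicalSequence 𝒜).map (shiftFunctor 𝒜 a) :=
    { τ₁ := hR.restrict n h
      τ₂ := h
      τ₃ := f
      comm₁₂ := rfl
      comm₂₃ := hf.symm }
  exact (ShortComplex.ShortExact.extClass_naturality (R.syzygySequence_shortExact n)
    (radicalSequence_shortExact.map_of_exact (shiftFunctor 𝒜 a)) τ).trans
      (congrArg (fun ξ => (Abelian.Ext.mk₀ f).comp ξ (zero_add 1))
        (Abelian.Ext.mapExactFunctor_extClass _ radicalSequence_shortExact).symm)

theorem yonedaHom_radicalClass (hR : R.IsMinimal) {Z : GrMod 𝒜} (n : ℕ) {a b : ℤ}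
    {h : R.P n ⟶ (shiftFunctor 𝒜 a).obj (regular 𝒜)}
    {f : R.syzygy n ⟶ (shiftFunctor 𝒜 a).obj (simpleTop 𝒜)}
    (hf : R.syzygyπ n ≫ f = h ≫ (shiftFunctor 𝒜 a).map (simpleTopπ 𝒜))
    (g : radical 𝒜 ⟶ (shiftFunctor 𝒜 b).obj Z) :
    yonedaHom (rfl : n + 1 = n + 1) a b
      ((radicalClass 𝒜).comp (Abelian.Ext.mk₀ g) (add_zero 1))
      ((R.syzygyClass n).comp (Abelian.Ext.mk₀ f) (add_zero n)) =
    (R.syzygyClass (n + 1)).comp (Abelian.Ext.mk₀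
      (hR.restrict n h ≫ (shiftFunctor 𝒜 a).map g ≫ Z.shiftShift a b)) (add_zero (n + 1)) := by
  rw [syzygyClass_succ_comp, ← Abelian.Ext.mk₀_comp_mk₀,
    ← Abelian.Ext.comp_assoc_of_third_deg_zero (R.stepClass n),
    hR.stepClass_comp_mk₀_restrict n hf]
  simp only [yonedaHom, Abelian.Ext.mapExactFunctor_comp, Abelian.Ext.mapExactFunctor_mk₀,
    Abelian.Ext.comp_assoc_of_third_deg_zero, Abelian.Ext.comp_assoc_of_second_deg_zero,
    Abelian.Ext.mk₀_comp_mk₀]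

end IsMinimal

end GrProjRes

section Koszul

variable {M : GrMod 𝒜} {R : GrProjRes M}

namespace GrProjRes.IsMinimal

theorem smul_kerD_le (hR : R.IsMinimal) (n : ℕ) :
    gradedRadical 𝒜 • R.kerD n ≤
      R.kerD n ⊓ gradedRadical 𝒜 • gradedRadical 𝒜 • (⊤ : Submodule A (R.P n)) :=
  le_inf Submodule.smul_le_right (Submodule.smul_mono le_rfl (hR.kerD_le n))

theorem yonedaSpan_le_ker_evalExt (hR : R.IsMinimal) (n : ℕ) {x : R.P n} (hxK : x ∈ R.kerD n)
    (hxJ : x ∈ gradedRadical 𝒜 • gradedRadical 𝒜 • (⊤ : Submodule A (R.P n))) :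
    yonedaSpan M (simpleTop 𝒜) (simpleTop 𝒜) 1 n (n + 1) rfl ≤
      (hR.evalExt (n + 1) (⟨x, hxK⟩ : R.kerD n)).ker := by
  refine yonedaSpan_le_of_homogeneous fun a b β α => ?_
  obtain ⟨g, rfl⟩ := exists_radicalClass_comp_mk₀_eq β
  obtain ⟨f, rfl⟩ := R.exists_syzygyClass_comp_mk₀_eq α
  obtain ⟨h, hf⟩ := R.exists_lift n f
  rw [hR.yonedaHom_radicalClass n hf g]
  exact (hR.evalExt_of (n + 1) _ _).trans (map_eq_zero_of_mem_smul_top radical_smul_simpleTop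
    (unshift ((shiftFunctor 𝒜 a).map g ≫ (simpleTop 𝒜).shiftShift a b))
    (unshift_restrictRadical_mem h (hR.kerD_le n) hxJ))

theorem smul_kerD_eq [IsSemisimpleRing (A ⧸ gradedRadical 𝒜)] (hR : R.IsMinimal) {n : ℕ}
    (hn : yonedaSpan M (simpleTop 𝒜) (simpleTop 𝒜) 1 n (n + 1) rfl = ⊤) :
    gradedRadical 𝒜 • R.kerD n =
      R.kerD n ⊓ gradedRadical 𝒜 • gradedRadical 𝒜 • (⊤ : Submodule A (R.P n)) := by
  refine le_antisymm (hR.smul_kerD_le n) fun x ⟨hxK, hxJ⟩ => ?_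
  by_contra hx
  let y : R.syzygy (n + 1) := (⟨x, hxK⟩ : R.kerD n)
  obtain ⟨l, u, hu⟩ := exists_unshift_ne_zero (x := y)
    (mt (Submodule.mem_smul_top_iff (gradedRadical 𝒜) (R.kerD n) ⟨x, hxK⟩).1 hx)
  refine hu ((hR.evalExt_of (n + 1) y u).symm.trans ?_)
  exact (hn.ge.trans (hR.yonedaSpan_le_ker_evalExt n hxK hxJ)) trivial

theorem of_extEquiv_restrict_comp_mem_yonedaSpan (hR : R.IsMinimal) (n : ℕ) {a l : ℤ}
    (h : R.P n ⟶ (shiftFunctor 𝒜 a).obj (regular 𝒜))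
    (g : (shiftFunctor 𝒜 a).obj (radical 𝒜) ⟶ (shiftFunctor 𝒜 l).obj (simpleTop 𝒜)) :
    GExt.of M (simpleTop 𝒜) (n + 1) l (hR.extEquiv (n + 1) l (hR.restrict n h ≫ g)) ∈
      yonedaSpan M (simpleTop 𝒜) (simpleTop 𝒜) 1 n (n + 1) rfl := by
  obtain ⟨b, rfl⟩ : ∃ b, l = a + b := ⟨l - a, by ring⟩
  obtain ⟨f, hf⟩ := hR.exists_descent n h
  let s : (shiftFunctor 𝒜 (a + b)).obj (simpleTop 𝒜) ⟶
      (shiftFunctor 𝒜 a).obj ((shiftFunctor 𝒜 b).obj (simpleTop 𝒜)) :=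
    ofLin (M := (simpleTop 𝒜).shift (a + b)) (N := ((simpleTop 𝒜).shift b).shift a)
      LinearMap.id fun i m (hm : m ∈ (simpleTop 𝒜).grading _) => by
        change m ∈ (simpleTop 𝒜).grading _
        rwa [add_assoc]
  obtain ⟨g', hg'⟩ := (shiftFunctor 𝒜 a).map_surjective (g ≫ s)
  have hg : (shiftFunctor 𝒜 a).map g' ≫ (simpleTop 𝒜).shiftShift a b = g := by
    rw [hg']
    rfl
  have hprod := hR.yonedaHom_radicalClass n hf g'
  rw [hg] at hprod
  refine (congrArg (GExt.of M (simpleTop 𝒜) (n + 1) (a + b)) hprod) ▸ ?_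
  rw [← yoneda_of]
  exact yoneda_mem_yonedaSpan _ _ _

theorem yonedaSpan_eq_top [IsSemisimpleRing (A ⧸ gradedRadical 𝒜)] (hR : R.IsMinimal) {n : ℕ}
    (B : DualBasis (R.P n))
    (hJ : gradedRadical 𝒜 • R.kerD n =
      R.kerD n ⊓ gradedRadical 𝒜 • gradedRadical 𝒜 • (⊤ : Submodule A (R.P n))) :
    yonedaSpan M (simpleTop 𝒜) (simpleTop 𝒜) 1 n (n + 1) rfl = ⊤ := by
  refine eq_top_iff.2 fun γ _ => ?_
  induction γ using DirectSum.induction_on with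
  | zero => exact zero_mem _
  | add x y hx hy => exact add_mem (hx trivial) (hy trivial)
  | of l x =>
    obtain ⟨u, rfl⟩ := (hR.extEquiv (n + 1) l).surjective x
    obtain ⟨s, g, hu⟩ := B.exists_factorization (hR.kerD_le n) hJ.ge u
    have hsum : hR.extEquiv (n + 1) l u =
        ∑ i ∈ s, hR.extEquiv (n + 1) l (hR.restrict n (B.coordHom i) ≫ g i) :=
      (congrArg _ hu).trans (map_sum _ _ s)
    rw [hsum, map_sum]
    exact sum_mem fun i _ => hR.of_extEquiv_restrict_comp_mem_yonedaSpan n (B.coordHom i) (g i)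

end GrProjRes.IsMinimal

theorem isQuasiKoszul_iff (hfin : IsLeftFiniteRing 𝒜) (hnoeth : IsNoetherianRing (𝒜 0))
    (hsemi : IsSemiperfectRing (𝒜 0)) (hM : M.IsLeftFinite) (hb : M.IsBoundedBelow) :
    M.IsQuasiKoszul ↔
      ∀ n : ℕ, yonedaSpan M (simpleTop 𝒜) (simpleTop 𝒜) 1 n (n + 1) rfl = ⊤ := by
  have := isSemisimpleRing_quotient_gradedRadical hsemi
  obtain ⟨R, hR, hB⟩ := exists_minimal_resolution hfin hnoeth hsemi hM hb
  exact ⟨fun h n => hR.yonedaSpan_eq_top (hB n).some (h.2 R hR n),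
    fun h => ⟨⟨R, hR⟩, fun R' hR' n => hR'.smul_kerD_eq (h n)⟩⟩

end Koszul

end RadicalClass

end GrMod

theorem ext_comp_square {C : Type*} [Category C] [Abelian C] [HasExt C]
    {X Y Z X' Y' Z' : C} {p q n : ℕ} {f : X ⟶ X'} {g : Y ⟶ Y'} {h : Z ⟶ Z'}
    {α : Abelian.Ext X Y p} {α' : Abelian.Ext X' Y' p} {β : Abelian.Ext Y Z q}
    {β' : Abelian.Ext Y' Z' q}
    (hα : α.comp (Abelian.Ext.mk₀ g) (add_zero p) = (Abelian.Ext.mk₀ f).comp α' (zero_add p))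
    (hβ : β.comp (Abelian.Ext.mk₀ h) (add_zero q) = (Abelian.Ext.mk₀ g).comp β' (zero_add q))
    (hn : p + q = n) :
    (α.comp β hn).comp (Abelian.Ext.mk₀ h) (add_zero n) =
      (Abelian.Ext.mk₀ f).comp (α'.comp β' hn) (zero_add n) := by
  rw [Abelian.Ext.comp_assoc_of_third_deg_zero, hβ, ← Abelian.Ext.comp_assoc_of_second_deg_zero,
    hα, Abelian.Ext.comp_assoc _ _ _ (zero_add p) hn (by lia)]

theorem mapExactFunctor_extClass_comp_mk₀_app {C : Type*} [Category C] [Abelian C] [HasExt C]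
    (F G H : C ⥤ C) [F.Additive] [PreservesFiniteLimits F] [PreservesFiniteColimits F]
    [G.Additive] [PreservesFiniteLimits G] [PreservesFiniteColimits G]
    [H.Additive] [PreservesFiniteLimits H] [PreservesFiniteColimits H]
    (τ : F ⋙ G ⟶ H) {S : ShortComplex C} (hS : S.ShortExact) :
    ((hS.extClass.mapExactFunctor F).mapExactFunctor G).comp
      (Abelian.Ext.mk₀ (τ.app S.X₁)) (add_zero 1) =
    (Abelian.Ext.mk₀ (τ.app S.X₃)).comp (hS.extClass.mapExactFunctor H) (zero_add 1) := by
  rw [Abelian.Ext.mapExactFunctor_extClass F, Abelian.Ext.mapExactFunctor_extClass H]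
  refine (congrArg (fun ξ => ξ.comp (Abelian.Ext.mk₀ (τ.app S.X₁)) (add_zero 1))
    (Abelian.Ext.mapExactFunctor_extClass G (hS.map_of_exact F))).trans ?_
  exact ShortComplex.ShortExact.extClass_naturality
    ((hS.map_of_exact F).map_of_exact G) (hS.map_of_exact H) (S.mapNatTrans τ)

namespace GrMod

variable {A : Type u} [Ring A] {𝒜 : ℕ → AddSubgroup A}

/-! ### The Yoneda product as the product of a graded category -/

section ShiftNaturality

theorem GrProjRes.ext_induction {X V : GrMod 𝒜} (R : GrProjRes X) {n : ℕ}
    {p : ∀ {Y Z : GrMod 𝒜} {m : ℕ}, Abelian.Ext.{u + 1} Y Z m → Prop}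
    (mk₀ : ∀ {Y Z : GrMod 𝒜} (f : Y ⟶ Z), p (Abelian.Ext.mk₀ f))
    (extClass : ∀ {S : ShortComplex (GrMod 𝒜)} (hS : S.ShortExact), p hS.extClass)
    (comp : ∀ {Y Z W : GrMod 𝒜} {i j m : ℕ} (h : i + j = m) (α : Abelian.Ext.{u + 1} Y Z i)
      (β : Abelian.Ext.{u + 1} Z W j), p α → p β → p (α.comp β h))
    (ξ : Abelian.Ext.{u + 1} X V n) : p ξ := by
  have hclass (m : ℕ) : p (R.syzygyClass m) := by
    induction m with
    | zero => exact mk₀ _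
    | succ m ih => exact comp _ _ _ ih (extClass _)
  obtain ⟨f, rfl⟩ := R.exists_syzygyClass_comp_mk₀_eq ξ
  exact comp _ _ _ (hclass n) (mk₀ f)

/-- The identity map `M(k) → M(k')` for `k = k'`. -/
def shiftCast (M : GrMod 𝒜) {k k' : ℤ} (h : k = k') :
    (shiftFunctor 𝒜 k).obj M ⟶ (shiftFunctor 𝒜 k').obj M :=
  ofLin (M := M.shift k) (N := M.shift k') LinearMap.id fun i m (hm : m ∈ M.grading _) => by
    change m ∈ M.grading _
    rwa [← h]

/-- The identity map `M → M(0)`. -/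
def shiftZero (M : GrMod 𝒜) : M ⟶ (shiftFunctor 𝒜 0).obj M :=
  ofLin (M := M) (N := M.shift 0) LinearMap.id fun i m hm => by
    change m ∈ M.grading _
    rwa [add_zero]

variable {X Y Z W : GrMod 𝒜} {n : ℕ}

theorem of_comp_mk₀_shiftCast {k k' : ℤ} (h : k = k')
    (x : Abelian.Ext.{u + 1} X ((shiftFunctor 𝒜 k).obj Z) n) :
    GExt.of X Z n k' (x.comp (Abelian.Ext.mk₀ (Z.shiftCast h)) (add_zero n)) =
      GExt.of X Z n k x := by
  subst h
  exact congrArg _ (Abelian.Ext.comp_mk₀_id x)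

theorem mapExactFunctor_comp_mk₀_shiftShift (R : GrProjRes X) (a b : ℤ)
    (ξ : Abelian.Ext.{u + 1} X Y n) :
    ((ξ.mapExactFunctor (shiftFunctor 𝒜 b)).mapExactFunctor (shiftFunctor 𝒜 a)).comp
      (Abelian.Ext.mk₀ (Y.shiftShift a b)) (add_zero n) =
    (Abelian.Ext.mk₀ (X.shiftShift a b)).comp
      (ξ.mapExactFunctor (shiftFunctor 𝒜 (a + b))) (zero_add n) := by
  refine R.ext_induction (p := fun {Y Z m} ξ =>
    ((ξ.mapExactFunctor (shiftFunctor 𝒜 b)).mapExactFunctor (shiftFunctor 𝒜 a)).comp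
      (Abelian.Ext.mk₀ (Z.shiftShift a b)) (add_zero m) =
    (Abelian.Ext.mk₀ (Y.shiftShift a b)).comp
      (ξ.mapExactFunctor (shiftFunctor 𝒜 (a + b))) (zero_add m))
    (fun f => ?_) (fun hS => ?_) (fun h α β hα hβ => ?_) ξ
  · simp only [Abelian.Ext.mapExactFunctor_mk₀, Abelian.Ext.mk₀_comp_mk₀]
    rfl
  · exact mapExactFunctor_extClass_comp_mk₀_app (shiftFunctor 𝒜 b) (shiftFunctor 𝒜 a)
      (shiftFunctor 𝒜 (a + b)) { app := fun M => M.shiftShift a b } hS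
  · simp only [Abelian.Ext.mapExactFunctor_comp]
    exact ext_comp_square hα hβ h

theorem comp_mk₀_shiftZero (R : GrProjRes X) (ξ : Abelian.Ext.{u + 1} X Y n) :
    ξ.comp (Abelian.Ext.mk₀ Y.shiftZero) (add_zero n) =
      (Abelian.Ext.mk₀ X.shiftZero).comp (ξ.mapExactFunctor (shiftFunctor 𝒜 0)) (zero_add n) := by
  refine R.ext_induction (p := fun {Y Z m} ξ =>
    ξ.comp (Abelian.Ext.mk₀ Z.shiftZero) (add_zero m) =
      (Abelian.Ext.mk₀ Y.shiftZero).comp (ξ.mapExactFunctor (shiftFunctor 𝒜 0)) (zero_add m))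
    (fun f => ?_) (fun hS => ?_) (fun h α β hα hβ => ?_) ξ
  · simp only [Abelian.Ext.mapExactFunctor_mk₀, Abelian.Ext.mk₀_comp_mk₀]
    rfl
  · let τ : 𝟭 (GrMod 𝒜) ⟶ shiftFunctor 𝒜 0 := { app := shiftZero }
    rw [Abelian.Ext.mapExactFunctor_extClass]
    exact ShortComplex.ShortExact.extClass_naturality _ _ (ShortComplex.mapNatTrans _ τ)
  · rw [Abelian.Ext.mapExactFunctor_comp]
    exact ext_comp_square hα hβ h

end ShiftNaturality

section YonedaCategory

variable {X Y Z W : GrMod 𝒜} {n p q r pq qr : ℕ}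

theorem of_yonedaHom_assoc (R : GrProjRes Z) {a b c : ℤ} (h₁ : q + p = pq) (h₂ : r + pq = n)
    (h₃ : r + q = qr) (h₄ : qr + p = n)
    (ξ : Abelian.Ext.{u + 1} Z ((shiftFunctor 𝒜 c).obj W) p)
    (β : Abelian.Ext.{u + 1} Y ((shiftFunctor 𝒜 b).obj Z) q)
    (α : Abelian.Ext.{u + 1} X ((shiftFunctor 𝒜 a).obj Y) r) :
    GExt.of X W n (a + (b + c)) (yonedaHom h₂ a (b + c) (yonedaHom h₁ b c ξ β) α) =
      GExt.of X W n (a + b + c) (yonedaHom h₄ (a + b) c ξ (yonedaHom h₃ a b β α)) := by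
  rw [← of_comp_mk₀_shiftCast (add_assoc a b c).symm]
  congr 1
  have hcoh : (shiftFunctor 𝒜 a).map (W.shiftShift b c) ≫ W.shiftShift a (b + c) ≫
      W.shiftCast (add_assoc a b c).symm =
      ((shiftFunctor 𝒜 c).obj W).shiftShift a b ≫ W.shiftShift (a + b) c := rfl
  simp only [yonedaHom, Abelian.Ext.mapExactFunctor_comp, Abelian.Ext.mapExactFunctor_mk₀,
    Abelian.Ext.comp_assoc_of_third_deg_zero, Abelian.Ext.mk₀_comp_mk₀, Category.assoc, hcoh]
  rw [← Abelian.Ext.mk₀_comp_mk₀,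
    ← Abelian.Ext.comp_assoc_of_third_deg_zero ((ξ.mapExactFunctor _).mapExactFunctor _),
    mapExactFunctor_comp_mk₀_shiftShift R, Abelian.Ext.comp_assoc_of_third_deg_zero,
    ← Abelian.Ext.comp_assoc_of_second_deg_zero]
  exact (Abelian.Ext.comp_assoc α _ _ h₃ h₁ (by lia)).symm

theorem yoneda_assoc (R : GrProjRes Z) (h₁ : q + p = pq) (h₂ : r + pq = n) (h₃ : r + q = qr)
    (h₄ : qr + p = n) (ξ : GExt Z W p) (β : GExt Y Z q) (α : GExt X Y r) :
    yoneda h₂ (yoneda h₁ ξ β) α = yoneda h₄ ξ (yoneda h₃ β α) := by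
  induction ξ using DirectSum.induction_on with
  | zero => simp only [map_zero, AddMonoidHom.zero_apply]
  | add x y hx hy => simp only [map_add, AddMonoidHom.add_apply, hx, hy]
  | of c ξ =>
    induction β using DirectSum.induction_on with
    | zero => simp only [map_zero, AddMonoidHom.zero_apply]
    | add x y hx hy => simp only [map_add, AddMonoidHom.add_apply, hx, hy]
    | of b β =>
      induction α using DirectSum.induction_on with
      | zero => simp only [map_zero]
      | add x y hx hy => simp only [map_add, hx, hy]
      | of a α =>
        rw [yoneda_of, yoneda_of, yoneda_of, yoneda_of]
        exact of_yonedaHom_assoc R h₁ h₂ h₃ h₄ ξ β α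

/-- The unit in `Hom(X, X) = Ext⁰(X, X)` of the Yoneda product. -/
noncomputable def yonedaOne (X : GrMod 𝒜) : GExt X X 0 :=
  GExt.of X X 0 0 (Abelian.Ext.mk₀ X.shiftZero)

theorem yonedaOne_yoneda (α : GExt X Y n) : yoneda (add_zero n) (yonedaOne Y) α = α := by
  induction α using DirectSum.induction_on with
  | zero => rw [map_zero]
  | add x y hx hy => rw [map_add, hx, hy]
  | of a α =>
    rw [yonedaOne, yoneda_of]
    refine Eq.trans ?_ (of_comp_mk₀_shiftCast (add_zero a).symm α)
    congr 1
    rw [yonedaHom, Abelian.Ext.mapExactFunctor_mk₀, Abelian.Ext.comp_assoc_of_third_deg_zero,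
      Abelian.Ext.mk₀_comp_mk₀]
    rfl

theorem yoneda_yonedaOne (R : GrProjRes X) (ξ : GExt X Y n) :
    yoneda (zero_add n) ξ (yonedaOne X) = ξ := by
  induction ξ using DirectSum.induction_on with
  | zero => rw [map_zero, AddMonoidHom.zero_apply]
  | add x y hx hy => rw [map_add, AddMonoidHom.add_apply, hx, hy]
  | of b ξ =>
    rw [yonedaOne, yoneda_of]
    refine Eq.trans ?_ (of_comp_mk₀_shiftCast (zero_add b).symm ξ)
    congr 1
    rw [yonedaHom, ← comp_mk₀_shiftZero R, Abelian.Ext.comp_assoc_of_third_deg_zero,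
      Abelian.Ext.mk₀_comp_mk₀]
    rfl

theorem yoneda_mem_yonedaSpan_of_left_mem (R : GrProjRes Z) (h₁ : q + p = pq) (h₂ : r + pq = n)
    (h₃ : r + q = qr) (h₄ : qr + p = n) {β : GExt Y W pq} (hβ : β ∈ yonedaSpan Y Z W p q pq h₁)
    (α : GExt X Y r) : yoneda h₂ β α ∈ yonedaSpan X Z W p qr n h₄ := by
  refine yonedaSpan_le (H := (yonedaSpan X Z W p qr n h₄).comap ((yoneda h₂).flip α))
    (fun ξ β => ?_) hβ
  change yoneda h₂ (yoneda h₁ ξ β) α ∈ yonedaSpan X Z W p qr n h₄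
  rw [yoneda_assoc R h₁ h₂ h₃ h₄]
  exact yoneda_mem_yonedaSpan h₄ ξ _

theorem yoneda_mem_yonedaSpan_of_right_mem (R : GrProjRes Z) (h₁ : q + p = pq) (h₂ : r + pq = n)
    (h₃ : r + q = qr) (h₄ : qr + p = n) (ξ : GExt Z W p) {γ : GExt X Z qr}
    (hγ : γ ∈ yonedaSpan X Y Z q r qr h₃) : yoneda h₄ ξ γ ∈ yonedaSpan X Y W pq r n h₂ := by
  refine yonedaSpan_le (H := (yonedaSpan X Y W pq r n h₂).comap (yoneda h₄ ξ))
    (fun β α => ?_) hγ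
  change yoneda h₄ ξ (yoneda h₃ β α) ∈ yonedaSpan X Y W pq r n h₂
  rw [← yoneda_assoc R h₁ h₂ h₃ h₄]
  exact yoneda_mem_yonedaSpan h₂ _ α

end YonedaCategory

/-! ### Generation of the Ext ring in degree one -/

section ExtRing

variable {S : GrMod 𝒜}

/-- The graded subring `Hom(S, S) ⊕ ⨁ₙ Ext¹(S, S) · Extⁿ(S, S)` of the Ext ring of `S`. It contains
`Ext¹(S, S)`, so that it is everything as soon as `Ext¹(S, S)` generates. -/
noncomputable def degreeOneMultiples (S : GrMod 𝒜) : (n : ℕ) → AddSubgroup (GExt S S n)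
  | 0 => ⊤
  | n + 1 => yonedaSpan S S S 1 n (n + 1) rfl

theorem degreeOneMultiples_one (R : GrProjRes S) : degreeOneMultiples S 1 = ⊤ := by
  refine eq_top_iff.2 fun ξ _ => ?_
  have hξ := yoneda_mem_yonedaSpan (zero_add 1) ξ (yonedaOne S)
  rwa [yoneda_yonedaOne R] at hξ

theorem yoneda_mem_degreeOneMultiples (R : GrProjRes S) {i j n : ℕ} (h : i + j = n)
    {β : GExt S S j} (hβ : β ∈ degreeOneMultiples S j) {α : GExt S S i}
    (hα : α ∈ degreeOneMultiples S i) : yoneda h β α ∈ degreeOneMultiples S n := by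
  rcases j with - | j
  · obtain rfl : i = n := h
    rcases i with - | i
    · trivial
    · exact yoneda_mem_yonedaSpan_of_right_mem R (add_zero 1) rfl rfl rfl β hα
  · obtain rfl : n = i + j + 1 := by lia
    exact yoneda_mem_yonedaSpan_of_left_mem R rfl h rfl rfl hβ α

theorem extRingGeneratedByDegreeOne_iff (R : GrProjRes S) :
    ExtRingGeneratedByDegreeOne S ↔ ∀ n : ℕ, yonedaSpan S S S 1 n (n + 1) rfl = ⊤ := by
  refine ⟨fun h n => h (degreeOneMultiples S) rfl (degreeOneMultiples_one R)
    (fun i j n hn β hβ α hα => yoneda_mem_degreeOneMultiples R hn hβ hα) (n + 1),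
    fun h T h₀ h₁ hT n => ?_⟩
  induction n with
  | zero => exact h₀
  | succ n ih =>
    rw [eq_top_iff, ← h n]
    exact yonedaSpan_le fun β α =>
      hT n 1 (n + 1) rfl β (h₁.ge trivial) α (ih.ge trivial)

theorem yonedaSpan_eq_top_iff (R : GrProjRes S) :
    (∀ i j : ℕ, yonedaSpan S S S j i (i + j) rfl = ⊤) ↔
      ∀ n : ℕ, yonedaSpan S S S 1 n (n + 1) rfl = ⊤ := by
  refine ⟨fun h n => h n 1, fun h i j => ?_⟩
  suffices hspan : ∀ n (hn : i + j = n), yonedaSpan S S S j i n hn = ⊤ from hspan _ rfl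
  induction j with
  | zero =>
    rintro n rfl
    refine eq_top_iff.2 fun α _ => ?_
    rw [← yonedaOne_yoneda α]
    exact yoneda_mem_yonedaSpan _ _ α
  | succ j ih =>
    intro n hn
    obtain rfl : n = i + j + 1 := by lia
    rw [eq_top_iff, ← h (i + j)]
    exact yonedaSpan_le fun ξ γ => yoneda_mem_yonedaSpan_of_right_mem R rfl hn rfl rfl ξ
      ((ih _ rfl).ge trivial)

end ExtRing

section SimpleTop

variable [GradedRing 𝒜]

theorem simpleTop_isLeftFinite (hfin : IsLeftFiniteRing 𝒜) : (simpleTop 𝒜).IsLeftFinite := by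
  intro k
  rw [← component_fg_iff]
  let π : regular 𝒜 →ₗ[SetLike.GradeZero.subring 𝒜] simpleTop 𝒜 :=
    (lin (simpleTopπ 𝒜)).restrictScalars _
  exact ((component_fg_iff k).2 (regular_isLeftFinite hfin k)).map π

theorem simpleTop_isBoundedBelow : (simpleTop 𝒜).IsBoundedBelow := by
  refine ⟨0, fun k hk => (AddSubgroup.eq_bot_iff_forall _).2 ?_⟩
  rintro _ ⟨(a : A), ha, rfl⟩
  have ha₀ : a = 0 := eq_zero_of_mem_intGrading (𝒜 := 𝒜) hk ha
  rw [ha₀]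
  exact map_zero _

end SimpleTop

end GrMod

theorem theorem3_general {A : Type u} [Ring A] (𝒜 : ℕ → AddSubgroup A) [GradedRing 𝒜]
    (hfin : IsLeftFiniteRing 𝒜)
    (hnoeth : IsNoetherianRing (𝒜 0)) (hsemi : IsSemiperfectRing (𝒜 0)) :
    (∀ M : GrMod 𝒜, M.IsLeftFinite → M.IsBoundedBelow →
      (M.IsQuasiKoszul ↔
        ∀ n : ℕ, GrMod.yonedaSpan M (GrMod.simpleTop 𝒜) (GrMod.simpleTop 𝒜) 1 n (n + 1) rfl = ⊤)) ∧
    ((GrMod.simpleTop 𝒜).IsQuasiKoszul ↔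
      GrMod.ExtRingGeneratedByDegreeOne (GrMod.simpleTop 𝒜)) ∧
    ((GrMod.simpleTop 𝒜).IsQuasiKoszul ↔
      ∀ i j : ℕ, GrMod.yonedaSpan (GrMod.simpleTop 𝒜) (GrMod.simpleTop 𝒜) (GrMod.simpleTop 𝒜)
        j i (i + j) rfl = ⊤) := by
  have hfinS := GrMod.simpleTop_isLeftFinite hfin
  have hbS := GrMod.simpleTop_isBoundedBelow (𝒜 := 𝒜)
  have hS := GrMod.isQuasiKoszul_iff hfin hnoeth hsemi hfinS hbS
  obtain ⟨R, -⟩ := GrMod.exists_minimal_resolution hfin hnoeth hsemi hfinS hbS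
  exact ⟨fun M hM hb => GrMod.isQuasiKoszul_iff hfin hnoeth hsemi hM hb,
    hS.trans (GrMod.extRingGeneratedByDegreeOne_iff R).symm,
    hS.trans (GrMod.yonedaSpan_eq_top_iff R).symm⟩

theorem theorem3 {A : Type u} [Ring A] (𝒜 : ℕ → AddSubgroup A) [GradedRing 𝒜]
    (hfin : IsLeftFiniteRing 𝒜) (hgen : IsGeneratedInDegreeOne 𝒜)
    (hnoeth : IsNoetherianRing (𝒜 0)) (hsemi : IsSemiperfectRing (𝒜 0)) :
    (∀ M : GrMod 𝒜, M.IsLeftFinite → M.IsBoundedBelow →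
      (M.IsQuasiKoszul ↔
        ∀ n : ℕ, GrMod.yonedaSpan M (GrMod.simpleTop 𝒜) (GrMod.simpleTop 𝒜) 1 n (n + 1) rfl = ⊤)) ∧
    ((GrMod.simpleTop 𝒜).IsQuasiKoszul ↔
      GrMod.ExtRingGeneratedByDegreeOne (GrMod.simpleTop 𝒜)) ∧
    ((GrMod.simpleTop 𝒜).IsQuasiKoszul ↔
      ∀ i j : ℕ, GrMod.yonedaSpan (GrMod.simpleTop 𝒜) (GrMod.simpleTop 𝒜) (GrMod.simpleTop 𝒜)
        j i (i + j) rfl = ⊤) :=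
  theorem3_general 𝒜 hfin hnoeth hsemi
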